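/- Let $a,b>0$, $\gamma,\widetilde\gamma\in\mathbb R$ and $\theta_2\in[-\pi,\pi]$. Consider the planar rectangular lattice graph with horizontal edges of length $a$ and vertical edges of length $b$, and let $\Gamma_0$ be the following period cell in the vertical direction (an infinite double-sided comb): $\Gamma_0$ has internal vertices $x_j$ and boundary vertices $x_j^+,x_j^-$, $j\in\mathbb Z$; for every $j$ there is an edge $e_j$ of length $a$ from $x_{j-1}$ to $x_j$, an edge $e_j^+$ of length $b/2$ from $x_j$ to $x_j^+$, and an edge $e_j^-$ of length $b/2$ from $x_j^-$ to $x_j$; every edge is coordinatized in the direction indicated. Let $\mathscr H_{\gamma,\widetilde\gamma}^{\theta_2}$ be the operator in $L^2(\Gamma_0)$ that acts as $\psi\mapsto-\psi''$ on every edge, with domain all $\psi\in L^2(\Gamma_0)$ that are $H^2$ on each edge, with $\psi''\in L^2(\Gamma_0)$, and satisfy, for every $j\in\mathbb Z$ (with $\psi_j,\psi_j^\pm$ the restrictions of $\psi$ to $e_j,e_j^\pm$): - the $\delta$-coupling at $x_j$: $\psi$ is continuous at $x_j$, and $$\psi_{j+1}'(x_j)-\psi_j'(x_j)+(\psi_j^+)'(x_j)-(\psi_j^-)'(x_j)=\gamma_j\,\psi(x_j),\qquad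 \gamma_0=\widetilde\gamma,\quad \gamma_j=\gamma\ \ (j\ne0);$$ - the quasiperiodic conditions $\psi_j^+(x_j^+)=\mathrm e^{i\theta_2}\psi_j^-(x_j^-)$ and $(\psi_j^+)'(x_j^+)=\mathrm e^{i\theta_2}(\psi_j^-)'(x_j^-)$. Put $\mathscr H_\gamma^{\theta_2}:=\mathscr H_{\gamma,\gamma}^{\theta_2}$. Let $\sigma$ denote the spectrum and $\sigma_{\rm disc}$ the discrete spectrum, i.e. the set of eigenvalues of finite multiplicity that are isolated points of the spectrum. For $\kappa>0$, $\tau\in[-1,1]$ and $g\in\mathbb R$ set $$\widehat f_g^{\,\tau}(\kappa):=\frac{g\,\sinh\kappa a}{2\kappa}+\frac{\sinh\kappa(a+b)}{\sinh\kappa b}-\tau\,\frac{\sinh\kappa a}{\sinh\kappa b}.$$ Let $E\in(-\infty,0)\setminus\sigma(\mathscr H_\gamma^{\theta_2})$, and set $\kappa=|E|^{1/2}$, $\tau=\cos\theta_2$. Then $E\in\sigma_{\rm disc}(\mathscr H_{\gamma,\widetilde\gamma}^{\theta_2})$ if and only if one of the following holds: - $\widehat f_\gamma^{\,\tau}(\kappa)<-1$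 and $\widehat f_{\widetilde\gamma}^{\,\tau}(\kappa)=\widehat f_\gamma^{\,\tau}(\kappa)+\sqrt{\widehat f_\gamma^{\,\tau}(\kappa)^2-1}$; - $\widehat f_\gamma^{\,\tau}(\kappa)>1$ and $\widehat f_{\widetilde\gamma}^{\,\tau}(\kappa)=\widehat f_\gamma^{\,\tau}(\kappa)-\sqrt{\widehat f_\gamma^{\,\tau}(\kappa)^2-1}$. -/

import Mathlib

open MeasureTheory

noncomputable section

/-! ### Resolvent set, spectrum and discrete spectrum of an unbounded operator -/

namespace UnboundedOp

variable {H : Type*} [NormedAddCommGroup H] [InnerProductSpace ℂ H]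

/-- `z` is in the resolvent set of `T` if `T - z`, as a map from the domain of `T` to `H`,
has a bounded everywhere defined two-sided inverse `R`. -/
def resolventSet (T : H →ₗ.[ℂ] H) : Set ℂ :=
  {z | ∃ R : H →L[ℂ] H,
    (∀ g : H, ∃ h : R g ∈ T.domain, T ⟨R g, h⟩ - z • R g = g) ∧
    ∀ ψ : T.domain, R (T ψ - z • (ψ : H)) = ψ}

/-- The spectrum: the complement of the resolvent set in `ℂ`. -/
def spectrum (T : H →ₗ.[ℂ] H) : Set ℂ := (resolventSet T)ᶜ

/-- The kernel of `T - z`, as a subspace of `H`. -/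
def eigenspace (T : H →ₗ.[ℂ] H) (z : ℂ) : Submodule ℂ H :=
  (LinearMap.ker (T.toFun - z • T.domain.subtype)).map T.domain.subtype

/-- The discrete spectrum (of a self-adjoint operator): the eigenvalues of finite multiplicity
which are isolated points of the spectrum. -/
def discreteSpectrum (T : H →ₗ.[ℂ] H) : Set ℂ :=
  {z | eigenspace T z ≠ ⊥ ∧ FiniteDimensional ℂ (eigenspace T z) ∧
    ∃ ε > 0, ∀ w ∈ spectrum T, dist w z < ε → w = z}

end UnboundedOp

/-! ### The comb graph `Γ₀` and the operators on it

`Γ₀` is a period cell, an infinite strip around one horizontal chain of vertices `x_j`, `j ∈ ℤ`,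
of the rectangular lattice with horizontal edges of length `a` and vertical edges of length `b`.
Every vertical edge is cut in its middle. -/

namespace Comb

/-- The edges of `Γ₀`, each of them identified with an interval `[0, ℓ]`:
* `chain j`, of length `a`, runs from `x_{j-1}` (coordinate `0`) to `x_j` (coordinate `a`);
* `up j`, of length `b / 2`, runs from `x_j` (coordinate `0`) to the boundary vertex `x_j⁺`
  (coordinate `b / 2`);
* `down j`, of length `b / 2`, runs from the boundary vertex `x_j⁻` (coordinate `0`) to `x_j`
  (coordinate `b / 2`). -/
inductive Edge : Type
  | chain (j : ℤ)
  | up (j : ℤ)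
  | down (j : ℤ)

/-- The length of an edge. -/
def Edge.length (a b : ℝ) : Edge → ℝ
  | .chain _ => a
  | .up _ => b / 2
  | .down _ => b / 2

/-- The Hilbert space `L²(Γ₀)`, the Hilbert sum of the spaces `L²(0, ℓ_e)` over all edges `e`. -/
abbrev L2 (a b : ℝ) : Type :=
  lp (fun e : Edge => Lp ℂ 2 (volume.restrict (Set.Ioc 0 (e.length a b)))) 2

/-- On `[0, ℓ]`, the function `F` is absolutely continuous with derivative `f`. (It is used only
for functions `f` that are integrable on `[0, ℓ]`.) -/
def IsPrimitive (ℓ : ℝ) (F f : ℝ → ℂ) : Prop :=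
  ∀ x ∈ Set.Icc 0 ℓ, F x = F 0 + ∫ t in (0 : ℝ)..x, f t

/-- `ψ` is twice weakly differentiable on every edge, with `ψ'' = w ∈ L²(Γ₀)`, and `u e`, `v e` are
the absolutely continuous representatives, on the closed edge `e`, of `ψ` and `ψ'`.
So `ψ` is in `H²` on every edge, and the values of `u e` and `v e` at `0` and at `ℓ_e` are the
traces of `ψ` and `ψ'` at the endpoints. (As only two edge lengths occur, `ψ, ψ'' ∈ L²(Γ₀)`
implies `ψ' ∈ L²(Γ₀)`, that is, `ψ` is in the Hilbert sum of the spaces `H²(0, ℓ_e)`.) -/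
structure IsH2 (a b : ℝ) (ψ w : L2 a b) (u v : Edge → ℝ → ℂ) : Prop where
  ae_eq : ∀ e, ψ e =ᵐ[volume.restrict (Set.Ioc 0 (e.length a b))] u e
  deriv₁ : ∀ e, IsPrimitive (e.length a b) (u e) (v e)
  deriv₂ : ∀ e, IsPrimitive (e.length a b) (v e) (w e)

/-- The `δ`-coupling of strength `g j` at every internal vertex `x_j` (continuity, and the sum of
the outgoing derivatives equals `g j` times the value), and the `θ`-quasiperiodic conditions
that relate the boundary vertices `x_j⁺` and `x_j⁻`. -/
structure VertexConditions (a b : ℝ) (g : ℤ → ℝ) (θ : ℝ) (u v : Edge → ℝ → ℂ) : Prop where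
  cont_right : ∀ j, u (.chain (j + 1)) 0 = u (.chain j) a
  cont_up : ∀ j, u (.up j) 0 = u (.chain j) a
  cont_down : ∀ j, u (.down j) (b / 2) = u (.chain j) a
  delta : ∀ j, v (.chain (j + 1)) 0 - v (.chain j) a + v (.up j) 0 - v (.down j) (b / 2)
    = (g j : ℂ) * u (.chain j) a
  quasi : ∀ j, u (.up j) (b / 2) = Complex.exp (θ * Complex.I) * u (.down j) 0
  quasi_deriv : ∀ j, v (.up j) (b / 2) = Complex.exp (θ * Complex.I) * v (.down j) 0

theorem intervalIntegrable_of_mem {a b : ℝ} (w : L2 a b) (e : Edge) {x : ℝ}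
    (hx : x ∈ Set.Icc 0 (e.length a b)) : IntervalIntegrable (w e) volume 0 x := by
  have h : Integrable (w e) (volume.restrict (Set.Ioc 0 (e.length a b))) :=
    (Lp.memLp (w e)).integrable (by norm_num)
  rw [intervalIntegrable_iff_integrableOn_Ioc_of_le hx.1]
  exact IntegrableOn.mono_set h (Set.Ioc_subset_Ioc_right hx.2)

theorem IsPrimitive.continuousOn {ℓ : ℝ} (hℓ : 0 ≤ ℓ) {F f : ℝ → ℂ} (h : IsPrimitive ℓ F f)
    (hf : IntervalIntegrable f volume 0 ℓ) : ContinuousOn F (Set.Icc 0 ℓ) := by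
  have h1 : ContinuousOn (fun x => ∫ t in (0 : ℝ)..x, f t) (Set.uIcc 0 ℓ) :=
    intervalIntegral.continuousOn_primitive_interval'  hf Set.left_mem_uIcc
  rw [Set.uIcc_of_le hℓ] at h1
  exact (continuousOn_const.add h1).congr h

theorem IsPrimitive.combine {ℓ : ℝ} {F f G g : ℝ → ℂ} (c : ℂ) (hF : IsPrimitive ℓ F f)
    (hG : IsPrimitive ℓ G g) (hf : ∀ x ∈ Set.Icc 0 ℓ, IntervalIntegrable f volume 0 x)
    (hg : ∀ x ∈ Set.Icc 0 ℓ, IntervalIntegrable g volume 0 x) :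
    IsPrimitive ℓ (fun x => c * F x + G x) (fun x => c * f x + g x) := by
  intro x hx
  rw [intervalIntegral.integral_add ((hf x hx).const_mul c) (hg x hx),
    intervalIntegral.integral_const_mul]
  simp only []
  rw [hF x hx, hG x hx]
  ring

theorem IsPrimitive.congr {ℓ : ℝ} {F f g : ℝ → ℂ} (hF : IsPrimitive ℓ F f)
    (h : f =ᵐ[volume.restrict (Set.Ioc 0 ℓ)] g) : IsPrimitive ℓ F g := by
  intro x hx
  rw [hF x hx]
  congr 1
  rw [intervalIntegral.integral_of_le hx.1, intervalIntegral.integral_of_le hx.1]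
  exact integral_congr_ae
    (ae_mono (Measure.restrict_mono (Set.Ioc_subset_Ioc_right hx.2) le_rfl) h)

theorem IsH2.intervalIntegrable {a b : ℝ} {ψ w : L2 a b} {u v : Edge → ℝ → ℂ}
    (h : IsH2 a b ψ w u v) (e : Edge) {x : ℝ} (hx : x ∈ Set.Icc 0 (e.length a b)) :
    IntervalIntegrable (v e) volume 0 x := by
  have hℓ : 0 ≤ e.length a b := hx.1.trans hx.2
  have h1 := (h.deriv₂ e).continuousOn hℓ (intervalIntegrable_of_mem w e ⟨hℓ, le_rfl⟩)
  apply ContinuousOn.intervalIntegrable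
  rw [Set.uIcc_of_le hx.1]
  exact h1.mono (Set.Icc_subset_Icc_right hx.2)

theorem IsH2.combine {a b : ℝ} {ψ₁ w₁ ψ₂ w₂ : L2 a b} {u₁ v₁ u₂ v₂ : Edge → ℝ → ℂ} (c : ℂ)
    (h₁ : IsH2 a b ψ₁ w₁ u₁ v₁) (h₂ : IsH2 a b ψ₂ w₂ u₂ v₂) :
    IsH2 a b (c • ψ₁ + ψ₂) (c • w₁ + w₂) (fun e x => c * u₁ e x + u₂ e x)
      (fun e x => c * v₁ e x + v₂ e x) := by
  have key : ∀ (f g : L2 a b) (e : Edge),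
      (c • f + g : L2 a b) e =ᵐ[volume.restrict (Set.Ioc 0 (e.length a b))]
        fun x => c * f e x + g e x := by
    intro f g e
    have e1 : (c • f + g : L2 a b) e = c • f e + g e := rfl
    rw [e1]
    filter_upwards [Lp.coeFn_add (c • f e) (g e), Lp.coeFn_smul c (f e)] with x hx1 hx2
    rw [hx1, Pi.add_apply, hx2, Pi.smul_apply, smul_eq_mul]
  refine ⟨fun e => ?_, fun e => ?_, fun e => ?_⟩
  · filter_upwards [key ψ₁ ψ₂ e, h₁.ae_eq e, h₂.ae_eq e] with x hx h1 h2
    rw [hx, h1, h2]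
  · exact (h₁.deriv₁ e).combine c (h₂.deriv₁ e) (fun x hx => h₁.intervalIntegrable e hx)
      (fun x hx => h₂.intervalIntegrable e hx)
  · exact ((h₁.deriv₂ e).combine c (h₂.deriv₂ e) (fun x hx => intervalIntegrable_of_mem w₁ e hx)
      (fun x hx => intervalIntegrable_of_mem w₂ e hx)).congr (key w₁ w₂ e).symm

theorem VertexConditions.combine {a b : ℝ} {g : ℤ → ℝ} {θ : ℝ} {u₁ v₁ u₂ v₂ : Edge → ℝ → ℂ} (c : ℂ)
    (h₁ : VertexConditions a b g θ u₁ v₁) (h₂ : VertexConditions a b g θ u₂ v₂) :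
    VertexConditions a b g θ (fun e x => c * u₁ e x + u₂ e x) (fun e x => c * v₁ e x + v₂ e x) where
  cont_right j := by simp only [h₁.cont_right, h₂.cont_right]
  cont_up j := by simp only [h₁.cont_up, h₂.cont_up]
  cont_down j := by simp only [h₁.cont_down, h₂.cont_down]
  delta j := by linear_combination c * h₁.delta j + h₂.delta j
  quasi j := by linear_combination c * h₁.quasi j + h₂.quasi j
  quasi_deriv j := by linear_combination c * h₁.quasi_deriv j + h₂.quasi_deriv j

theorem isH2_zero (a b : ℝ) : IsH2 a b 0 0 (fun _ _ => 0) (fun _ _ => 0) := by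
  have key : ∀ e : Edge, (0 : L2 a b) e =ᵐ[volume.restrict (Set.Ioc 0 (e.length a b))]
      fun _ => (0 : ℂ) := fun e => Lp.coeFn_zero ℂ 2 _
  refine ⟨key, fun e x _ => by simp, fun e => ?_⟩
  refine IsPrimitive.congr (f := fun _ => 0) (fun x _ => by simp) (key e).symm

/-- The graph of the Hamiltonian on `Γ₀` with `δ`-couplings of strengths `g j` at `x_j` and
quasimomentum `θ`: the pairs `(ψ, -ψ'')`, where `ψ` is in `H²` on the edges and satisfies the
vertex conditions. -/
def graph (a b : ℝ) (g : ℤ → ℝ) (θ : ℝ) : Submodule ℂ (L2 a b × L2 a b) where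
  carrier := {p | ∃ u v : Edge → ℝ → ℂ, IsH2 a b p.1 (-p.2) u v ∧ VertexConditions a b g θ u v}
  zero_mem' := by
    refine ⟨fun _ _ => 0, fun _ _ => 0, ?_, ?_⟩
    · simpa using isH2_zero a b
    · constructor <;> simp
  add_mem' := by
    rintro p q ⟨u₁, v₁, h₁, k₁⟩ ⟨u₂, v₂, h₂, k₂⟩
    refine ⟨_, _, ?_, k₁.combine 1 k₂⟩
    have := h₁.combine 1 h₂
    rw [one_smul, one_smul, ← neg_add] at this
    exact this
  smul_mem' := by
    rintro c p ⟨u₁, v₁, h₁, k₁⟩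
    have k₀ : VertexConditions a b g θ (fun _ _ => 0) (fun _ _ => 0) := by constructor <;> simp
    refine ⟨_, _, ?_, k₁.combine c k₀⟩
    have := h₁.combine c (isH2_zero a b)
    rw [add_zero, add_zero, smul_neg] at this
    exact this

/-- The Hamiltonian on `Γ₀` with `δ`-couplings of strengths `g j` at `x_j` and quasimomentum `θ`:
the unbounded operator `ψ ↦ -ψ''` in `L²(Γ₀)`, with the domain that `graph` describes. -/
def hamiltonian (a b : ℝ) (g : ℤ → ℝ) (θ : ℝ) : L2 a b →ₗ.[ℂ] L2 a b :=
  (graph a b g θ).toLinearPMap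

/-- The operator `H_{γ, γ'}^θ`: the coupling strength is `γ'` at `x_0` and `γ` at the other
vertices `x_j`. -/
def perturbed (a b γ γ' θ : ℝ) : L2 a b →ₗ.[ℂ] L2 a b :=
  hamiltonian a b (fun j => if j = 0 then γ' else γ) θ

/-- The operator `H_γ^θ`: the coupling strength is `γ` at all vertices `x_j`. -/
def unperturbed (a b γ θ : ℝ) : L2 a b →ₗ.[ℂ] L2 a b :=
  perturbed a b γ γ θ

theorem IsPrimitive.ae_eq_zero {ℓ : ℝ} (hℓ : 0 < ℓ) {F f : ℝ → ℂ} (h : IsPrimitive ℓ F f)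
    (hf : IntervalIntegrable f volume 0 ℓ)
    (hF : ∀ᵐ x ∂volume.restrict (Set.Ioc 0 ℓ), F x = 0) :
    (∀ x ∈ Set.Icc 0 ℓ, F x = 0) ∧ ∀ᵐ x ∂volume.restrict (Set.Ioc 0 ℓ), f x = 0 := by
  have h0 : Set.EqOn F (fun _ => 0) (Set.Icc 0 ℓ) := by
    refine Measure.eqOn_Icc_of_ae_eq (μ := volume) hℓ.ne ?_ (h.continuousOn hℓ.le hf)
      continuousOn_const
    rw [← Measure.restrict_congr_set Ioc_ae_eq_Icc]
    exact hF
  refine ⟨h0, ?_⟩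
  have hd := hf.ae_hasDerivAt_integral
  rw [← Measure.restrict_congr_set Ioo_ae_eq_Ioc, ae_restrict_iff' measurableSet_Ioo]
  filter_upwards [hd] with x hx hx'
  have h1 := hx (by rw [Set.uIcc_of_le hℓ.le]; exact Set.Ioo_subset_Icc_self hx') 0
    Set.left_mem_uIcc
  have h2 : (fun y => ∫ t in (0 : ℝ)..y, f t) =ᶠ[nhds x] fun _ => 0 := by
    filter_upwards [Ioo_mem_nhds hx'.1 hx'.2] with y hy
    have e1 := h y (Set.Ioo_subset_Icc_self hy)
    rw [h0 (Set.Ioo_subset_Icc_self hy), h0 ⟨le_rfl, hℓ.le⟩, zero_add] at e1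
    exact e1.symm
  exact h1.unique ((hasDerivAt_const x (0 : ℂ)).congr_of_eventuallyEq h2)

/-- The graph is that of an operator: `ψ''` is determined by `ψ`. -/
theorem graph_single_valued {a b : ℝ} (ha : 0 < a) (hb : 0 < b) (g : ℤ → ℝ) (θ : ℝ) :
    ∀ p : L2 a b × L2 a b, p ∈ graph a b g θ → p.1 = 0 → p.2 = 0 := by
  rintro ⟨ψ, w⟩ ⟨u, v, h, -⟩ (rfl : ψ = 0)
  have hw : (-w : L2 a b) = 0 := by
    ext1
    funext e
    have hℓ : 0 < e.length a b := by
      cases e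
      · exact ha
      · exact half_pos hb
      · exact half_pos hb
    have hm : e.length a b ∈ Set.Icc 0 (e.length a b) := ⟨hℓ.le, le_rfl⟩
    have hu : ∀ᵐ x ∂volume.restrict (Set.Ioc 0 (e.length a b)), u e x = 0 := by
      filter_upwards [h.ae_eq e, (isH2_zero a b).ae_eq e] with x h1 h2
      rw [← h1, ← h2]
    have hv := ((h.deriv₁ e).ae_eq_zero hℓ (h.intervalIntegrable e hm) hu).2
    have hw := ((h.deriv₂ e).ae_eq_zero hℓ (intervalIntegrable_of_mem (-w) e hm) hv).2
    exact (Lp.eq_zero_iff_ae_eq_zero).2 hw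
  exact neg_eq_zero.1 hw

/-- So `hamiltonian` is the operator with the graph `graph`. -/
theorem hamiltonian_graph {a b : ℝ} (ha : 0 < a) (hb : 0 < b) (g : ℤ → ℝ) (θ : ℝ) :
    (hamiltonian a b g θ).graph = graph a b g θ :=
  Submodule.toLinearPMap_graph_eq _ fun p hp h0 => graph_single_valued ha hb g θ p hp h0

/-- The function `κ ↦ f̂_γ^τ(κ)`, for `κ > 0`. -/
def fHat (a b γ τ κ : ℝ) : ℝ :=
  γ * Real.sinh (κ * a) / (2 * κ) + Real.sinh (κ * (a + b)) / Real.sinh (κ * b)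
    - τ * (Real.sinh (κ * a) / Real.sinh (κ * b))

end Comb

end

/-! ### Integration by parts for absolutely continuous functions on an interval. -/

noncomputable section

namespace Comb

/-! On each edge an eigenfunction for `E = -κ²` is a combination of `cosh κx` and `sinh κx`.
Eliminating the vertical edges by the quasiperiodic conditions turns the δ-coupling into a scalar
difference equation for the values `y j` at `x_j`, namely `y (j+1) + y (j-1) = 2 f_j y j`, where
`f_j` is `fHat` with the coupling constant of `x_j` (`recursion_of_eigenfunction`; conversely
`exists_eigenfunction`).

Away from `0` the characteristic roots are `μ` and `1/μ` with `μ² - 2fμ + 1 = 0`. A decaying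
two-sided solution needs a root with `|μ| < 1`, hence `|f| > 1`, and must be a multiple of `μ^|j|`;
the equation at `0` then says `f' = μ`. These are the two alternatives (`dichotomy_of_recursion`,
`exists_decaying_solution`). The value at `x_0` cannot vanish: otherwise the eigenfunction would
satisfy the unperturbed conditions, although `E` is in the unperturbed resolvent set.

For the converse, an eigenfunction `η` is not enough: `E` must also be isolated with finite
multiplicity. The two operators differ only through the value at `x_0`, so the eigenspace is a line,
and Green's identity on the comb (`green`) shows that the unperturbed resolvent at `E` maps the
orthogonal complement of `η` into the perturbed domain. This gives a reduced resolvent, from which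
the resolvent near `E` is built by a Neumann series (`exists_isolating_ball`). -/

theorem absolutelyContinuousOnInterval_integral {f : ℝ → ℂ} {ℓ : ℝ}
    (hf : IntervalIntegrable f volume 0 ℓ) :
    AbsolutelyContinuousOnInterval (fun x => ∫ t in (0 : ℝ)..x, f t) 0 ℓ := by
  -- The increments of the primitive of `f` are dominated by those of the primitive of `‖f‖`.
  have h := hf.norm.absolutelyContinuousOnInterval_intervalIntegral (c := 0) Set.left_mem_uIcc
  unfold AbsolutelyContinuousOnInterval at h ⊢
  refine squeeze_zero' (Filter.Eventually.of_forall fun _ => Finset.sum_nonneg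
    fun i _ => dist_nonneg) ?_ h
  rw [Filter.eventually_inf_principal]
  filter_upwards with I hI
  refine Finset.sum_le_sum fun i hi => ?_
  have hm := hI.1 i hi
  have hint : ∀ x ∈ Set.uIcc 0 ℓ, IntervalIntegrable f volume 0 x := fun x hx =>
    hf.mono_set (Set.uIcc_subset_uIcc Set.left_mem_uIcc hx)
  rw [dist_eq_norm, dist_eq_norm,
    intervalIntegral.integral_interval_sub_left (hint _ hm.1) (hint _ hm.2),
    intervalIntegral.integral_interval_sub_left (hint _ hm.1).norm (hint _ hm.2).norm]
  exact intervalIntegral.norm_integral_le_abs_integral_norm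

/-- The difference of the two sides, as a function of the upper limit, is absolutely continuous with
derivative zero almost everywhere, hence constant. -/
theorem const_add_integral_mul {f g : ℝ → ℂ} {ℓ : ℝ} (c d : ℂ)
    (hf : IntervalIntegrable f volume 0 ℓ) (hg : IntervalIntegrable g volume 0 ℓ) :
    (c + ∫ t in (0 : ℝ)..ℓ, f t) * (d + ∫ t in (0 : ℝ)..ℓ, g t) = c * d +
      ∫ t in (0 : ℝ)..ℓ, (f t * (d + ∫ s in (0 : ℝ)..t, g s) +
        (c + ∫ s in (0 : ℝ)..t, f s) * g t) := by
  have hF := absolutelyContinuousOnInterval_integral hf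
  have hG := absolutelyContinuousOnInterval_integral hg
  have hconst : ∀ c : ℂ, AbsolutelyContinuousOnInterval (fun _ : ℝ => c) 0 ℓ := fun c =>
    contDiff_const.contDiffOn.absolutelyContinuousOnInterval
  have hF' := (hconst c).fun_add hF
  have hG' := (hconst d).fun_add hG
  have hint : IntervalIntegrable (fun t => f t * (d + ∫ s in (0 : ℝ)..t, g s) +
      (c + ∫ s in (0 : ℝ)..t, f s) * g t) volume 0 ℓ :=
    (hf.mul_continuousOn hG'.continuousOn).add (hg.continuousOn_mul hF'.continuousOn)
  have hP := (hF'.fun_smul hG').fun_sub (absolutelyContinuousOnInterval_integral hint)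
  obtain ⟨C, hC⟩ := hP.const_of_ae_hasDerivAt_zero (by
    filter_upwards [hf.ae_hasDerivAt_integral, hg.ae_hasDerivAt_integral,
      hint.ae_hasDerivAt_integral] with x h1 h2 h3 hx
    have k1 := (h1 hx 0 Set.left_mem_uIcc).const_add c
    have k2 := (h2 hx 0 Set.left_mem_uIcc).const_add d
    have k3 := h3 hx 0 Set.left_mem_uIcc
    have := (k1.mul k2).sub k3
    rw [sub_self] at this
    exact this)
  have e1 := hC 0 Set.left_mem_uIcc
  have e2 := hC ℓ Set.right_mem_uIcc
  simp only [intervalIntegral.integral_same, add_zero, sub_zero, smul_eq_mul] at e1 e2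
  rw [← e1] at e2
  linear_combination e2

/-- The Leibniz rule for absolutely continuous functions. -/
theorem IsPrimitive.mul {ℓ : ℝ} {F f G g : ℝ → ℂ} (hF : IsPrimitive ℓ F f)
    (hG : IsPrimitive ℓ G g) (hf : IntervalIntegrable f volume 0 ℓ)
    (hg : IntervalIntegrable g volume 0 ℓ) :
    IsPrimitive ℓ (fun x => F x * G x) (fun x => f x * G x + F x * g x) := by
  intro x hx
  have hsub : Set.uIcc 0 x ⊆ Set.uIcc 0 ℓ := by
    rw [Set.uIcc_of_le hx.1, Set.uIcc_of_le (hx.1.trans hx.2)]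
    exact Set.Icc_subset_Icc_right hx.2
  have h := const_add_integral_mul (F 0) (G 0) (hf.mono_set hsub) (hg.mono_set hsub)
  rw [← hF x hx, ← hG x hx] at h
  simp only []
  rw [h]
  congr 1
  refine intervalIntegral.integral_congr fun t ht => ?_
  rw [Set.uIcc_of_le hx.1] at ht
  have ht' : t ∈ Set.Icc 0 ℓ := ⟨ht.1, ht.2.trans hx.2⟩
  rw [← hF t ht', ← hG t ht']

theorem isPrimitive_of_hasDerivAt {ℓ : ℝ} {F f : ℝ → ℂ} (h : ∀ x, HasDerivAt F (f x) x)
    (hf : Continuous f) : IsPrimitive ℓ F f := by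
  intro x _
  rw [intervalIntegral.integral_eq_sub_of_hasDerivAt (fun t _ => h t) (hf.intervalIntegrable _ _)]
  ring

theorem IsPrimitive.conj {ℓ : ℝ} {F f : ℝ → ℂ} (h : IsPrimitive ℓ F f) :
    IsPrimitive ℓ (fun x => starRingEnd ℂ (F x)) (fun x => starRingEnd ℂ (f x)) := by
  intro x hx
  simp only []
  rw [h x hx, map_add, intervalIntegral.integral_of_le hx.1, intervalIntegral.integral_of_le hx.1,
    integral_conj]

theorem intervalIntegrable_conj {f : ℝ → ℂ} {c d : ℝ} (h : IntervalIntegrable f volume c d) :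
    IntervalIntegrable (fun x => starRingEnd ℂ (f x)) volume c d := by
  rw [intervalIntegrable_iff] at h ⊢
  exact (Complex.conjCLE : ℂ →L[ℝ] ℂ).integrable_comp h

/-- Green's second identity on an interval. -/
theorem integral_green {ℓ : ℝ} (hℓ : 0 ≤ ℓ) {u₁ v₁ w₁ u₂ v₂ w₂ : ℝ → ℂ}
    (h₁ : IsPrimitive ℓ u₁ v₁) (k₁ : IsPrimitive ℓ v₁ w₁) (h₂ : IsPrimitive ℓ u₂ v₂)
    (k₂ : IsPrimitive ℓ v₂ w₂) (hw₁ : IntervalIntegrable w₁ volume 0 ℓ)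
    (hw₂ : IntervalIntegrable w₂ volume 0 ℓ) :
    ∫ x in (0 : ℝ)..ℓ, (u₁ x * w₂ x - w₁ x * u₂ x) =
      (u₁ ℓ * v₂ ℓ - v₁ ℓ * u₂ ℓ) - (u₁ 0 * v₂ 0 - v₁ 0 * u₂ 0) := by
  have hI : Set.uIcc 0 ℓ = Set.Icc 0 ℓ := Set.uIcc_of_le hℓ
  have cv₁ := k₁.continuousOn hℓ hw₁
  have cv₂ := k₂.continuousOn hℓ hw₂
  rw [← hI] at cv₁ cv₂
  have iv₁ := cv₁.intervalIntegrable (μ := volume)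
  have iv₂ := cv₂.intervalIntegrable (μ := volume)
  have cu₁ := h₁.continuousOn hℓ iv₁
  have cu₂ := h₂.continuousOn hℓ iv₂
  rw [← hI] at cu₁ cu₂
  -- Subtracting the Leibniz rules for `u₁ v₂` and `v₁ u₂` cancels the common term `v₁ v₂`.
  have A := h₁.mul k₂ iv₁ hw₂ ℓ ⟨hℓ, le_rfl⟩
  have B := k₁.mul h₂ hw₁ iv₂ ℓ ⟨hℓ, le_rfl⟩
  simp only [] at A B
  have iA : IntervalIntegrable (fun x => v₁ x * v₂ x + u₁ x * w₂ x) volume 0 ℓ :=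
    (iv₁.mul_continuousOn cv₂).add (hw₂.continuousOn_mul cu₁)
  have iB : IntervalIntegrable (fun x => w₁ x * u₂ x + v₁ x * v₂ x) volume 0 ℓ :=
    (hw₁.mul_continuousOn cu₂).add (iv₁.mul_continuousOn cv₂)
  have : ∫ x in (0 : ℝ)..ℓ, (u₁ x * w₂ x - w₁ x * u₂ x) =
      (∫ x in (0 : ℝ)..ℓ, (v₁ x * v₂ x + u₁ x * w₂ x)) -
      ∫ x in (0 : ℝ)..ℓ, (w₁ x * u₂ x + v₁ x * v₂ x) := by
    rw [← intervalIntegral.integral_sub iA iB]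
    exact intervalIntegral.integral_congr fun x _ => by ring
  rw [this]
  linear_combination B - A

end Comb
end

/-! ### Decay of traces and Green's identity on the comb. -/

noncomputable section

namespace Comb

open Filter Topology

theorem Edge.length_pos {a b : ℝ} (ha : 0 < a) (hb : 0 < b) (e : Edge) : 0 < e.length a b := by
  cases e
  · exact ha
  · exact half_pos hb
  · exact half_pos hb

theorem summable_norm_sq {a b : ℝ} (w : L2 a b) : Summable fun e => ‖w e‖ ^ (2 : ℕ) := by
  have h := (memℓp_gen_iff (by norm_num : 0 < (2 : ENNReal).toReal)).1 (lp.memℓp w)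
  simpa using h

theorem tendsto_norm_chain {a b : ℝ} (w : L2 a b) :
    Tendsto (fun j : ℤ => ‖w (.chain j)‖) cofinite (𝓝 0) := by
  have h := (summable_norm_sq w).tendsto_cofinite_zero
  have hinj : Function.Injective Edge.chain := fun i j h => by injection h
  have h1 := (Real.continuous_sqrt.tendsto 0).comp (h.comp hinj.tendsto_cofinite)
  rw [Real.sqrt_zero] at h1
  refine h1.congr fun j => ?_
  simp [Real.sqrt_sq]

theorem memLp_of_continuous {ℓ : ℝ} {h : ℝ → ℂ} (hh : Continuous h) :
    MemLp h 2 (volume.restrict (Set.Ioc 0 ℓ)) := by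
  obtain ⟨C, hC⟩ := (isCompact_Icc (a := (0 : ℝ)) (b := ℓ)).exists_bound_of_continuousOn
    hh.continuousOn
  refine MemLp.of_bound hh.aestronglyMeasurable C ?_
  rw [ae_restrict_iff' measurableSet_Ioc]
  exact Eventually.of_forall fun x hx => hC x (Set.Ioc_subset_Icc_self hx)

theorem inner_eq_intervalIntegral {ℓ : ℝ} (hℓ : 0 ≤ ℓ)
    (f g : Lp ℂ 2 (volume.restrict (Set.Ioc 0 ℓ))) {f' g' : ℝ → ℂ}
    (hf : f =ᵐ[volume.restrict (Set.Ioc 0 ℓ)] f') (hg : g =ᵐ[volume.restrict (Set.Ioc 0 ℓ)] g') :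
    inner ℂ f g = ∫ x in (0 : ℝ)..ℓ, starRingEnd ℂ (f' x) * g' x := by
  rw [L2.inner_def, intervalIntegral.integral_of_le hℓ]
  refine integral_congr_ae ?_
  filter_upwards [hf, hg] with x h1 h2
  rw [h1, h2, RCLike.inner_apply, mul_comm]

/-- By Cauchy–Schwarz, since the norms of `w` on the chain edges are square summable and `h` is the
same on every edge. -/
theorem tendsto_integral_chain {a b : ℝ} (ha : 0 ≤ a) (w : L2 a b) {u : Edge → ℝ → ℂ}
    (hu : ∀ e, w e =ᵐ[volume.restrict (Set.Ioc 0 (e.length a b))] u e) {h : ℝ → ℂ}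
    (hh : Continuous h) :
    Tendsto (fun j : ℤ => ∫ x in (0 : ℝ)..a, h x * u (.chain j) x) cofinite (𝓝 0) := by
  have hc : Continuous fun x => starRingEnd ℂ (h x) := Complex.continuous_conj.comp hh
  set k := (memLp_of_continuous (ℓ := a) hc).toLp with hk
  have key : ∀ j : ℤ, ‖∫ x in (0 : ℝ)..a, h x * u (.chain j) x‖ ≤ ‖k‖ * ‖w (.chain j)‖ := by
    intro j
    have := inner_eq_intervalIntegral ha k (w (.chain j)) (MemLp.coeFn_toLp _) (hu (.chain j))
    simp only [Complex.conj_conj] at this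
    rw [← this]
    exact norm_inner_le_norm (𝕜 := ℂ) k (w (.chain j))
  refine squeeze_zero_norm key ?_
  simpa using (tendsto_norm_chain w).const_mul ‖k‖

/-- The traces of `ψ` and `ψ'` at the vertices of the chain tend to zero. -/
theorem IsH2.tendsto_trace {a b : ℝ} (ha : 0 < a) {ψ w : L2 a b} {u v : Edge → ℝ → ℂ}
    (H : IsH2 a b ψ w u v) :
    Tendsto (fun j : ℤ => u (.chain j) 0) cofinite (𝓝 0) ∧
      Tendsto (fun j : ℤ => v (.chain j) 0) cofinite (𝓝 0) := by
  have ha' : (a : ℂ) ≠ 0 := by exact_mod_cast ha.ne'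
  have poly : ∀ (c₀ c₁ c₂ c₃ : ℂ) (x : ℝ),
      HasDerivAt (fun x : ℝ => c₀ + c₁ * x + c₂ * (x : ℂ) ^ 2 + c₃ * (x : ℂ) ^ 3)
        (c₁ + 2 * c₂ * x + 3 * c₃ * (x : ℂ) ^ 2) x := by
    intro c₀ c₁ c₂ c₃ x
    have h1 : HasDerivAt (fun x : ℝ => (x : ℂ)) 1 x := Complex.ofRealCLM.hasDerivAt
    have := (((h1.const_mul c₁).const_add c₀).fun_add ((h1.fun_pow 2).const_mul c₂)).fun_add
      ((h1.fun_pow 3).const_mul c₃)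
    refine this.congr_deriv ?_
    push_cast
    ring
  -- Green's identity against a cubic with a double zero at `a` leaves only the traces at `0`,
  -- expressed by integrals over the edge of `ψ` and `w`.
  have test : ∀ c₀ c₁ c₂ c₃ : ℂ, c₀ + c₁ * a + c₂ * (a : ℂ) ^ 2 + c₃ * (a : ℂ) ^ 3 = 0 →
      c₁ + 2 * c₂ * a + 3 * c₃ * (a : ℂ) ^ 2 = 0 →
      Tendsto (fun j : ℤ => c₀ * v (.chain j) 0 - c₁ * u (.chain j) 0) cofinite (𝓝 0) := by
    intro c₀ c₁ c₂ c₃ e1 e2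
    have d1 := poly c₀ c₁ c₂ c₃
    have d2 : ∀ x : ℝ, HasDerivAt (fun x : ℝ => c₁ + 2 * c₂ * x + 3 * c₃ * (x : ℂ) ^ 2)
        (2 * c₂ + 6 * c₃ * x) x := fun x => by
      have := poly c₁ (2 * c₂) (3 * c₃) 0 x
      simp only [zero_mul, add_zero, mul_zero] at this
      exact this.congr_deriv (by ring)
    have c0 : Continuous fun x : ℝ => c₀ + c₁ * x + c₂ * (x : ℂ) ^ 2 + c₃ * (x : ℂ) ^ 3 := by
      fun_prop
    have c1 : Continuous fun x : ℝ => c₁ + 2 * c₂ * x + 3 * c₃ * (x : ℂ) ^ 2 := by fun_prop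
    have c2 : Continuous fun x : ℝ => 2 * c₂ + 6 * c₃ * x := by fun_prop
    have t1 := tendsto_integral_chain ha.le w (fun e => Filter.EventuallyEq.rfl) c0
    have t2 := tendsto_integral_chain ha.le ψ H.ae_eq c2
    have t := t2.sub t1
    rw [sub_zero] at t
    refine t.congr fun j => ?_
    have hi := intervalIntegrable_of_mem w (.chain j) (x := a) ⟨ha.le, le_rfl⟩
    have hv := H.intervalIntegrable (.chain j) (x := a) ⟨ha.le, le_rfl⟩
    have hu := (H.deriv₁ (.chain j)).continuousOn ha.le hv
    have hu' : IntervalIntegrable (u (.chain j)) volume 0 a :=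
      ContinuousOn.intervalIntegrable (by rw [Set.uIcc_of_le ha.le]; exact hu)
    have := integral_green ha.le (isPrimitive_of_hasDerivAt d1 c1)
      (isPrimitive_of_hasDerivAt d2 c2) (H.deriv₁ (.chain j)) (H.deriv₂ (.chain j))
      (c2.intervalIntegrable _ _) hi
    rw [intervalIntegral.integral_sub (hi.continuousOn_mul c0.continuousOn)
      (hu'.continuousOn_mul c2.continuousOn), e1, e2] at this
    simp only [Complex.ofReal_zero] at this
    linear_combination -this
  constructor
  -- The cubic Hermite polynomials at `0`: here `-x(1 - x/a)²`, which isolates `u`, and below `(1 -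
  -- x/a)²(1 + 2x/a)`, which isolates `v`.
  · have := test 0 (-1) (2 / a) (-1 / a ^ 2) (by field_simp; ring) (by field_simp; ring)
    simpa using this
  · have := test 1 0 (-3 / a ^ 2) (2 / a ^ 3) (by field_simp; ring) (by field_simp; ring)
    simpa using this

/-- The edges of the comb, grouped by the vertex `x_j`. -/
def edgeEquiv : ℤ × Fin 3 ≃ Edge where
  toFun p := ![Edge.chain p.1, Edge.up p.1, Edge.down p.1] p.2
  invFun
    | .chain j => (j, 0)
    | .up j => (j, 1)
    | .down j => (j, 2)
  left_inv := by
    rintro ⟨j, k⟩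
    fin_cases k <;> rfl
  right_inv := by
    rintro (j | j | j) <;> rfl

theorem hasSum_edge {E : Type*} [NormedAddCommGroup E] {s : Edge → E} {A : E} (h : HasSum s A) :
    HasSum (fun j : ℤ => s (.chain j) + s (.up j) + s (.down j)) A := by
  have h1 := (edgeEquiv.hasSum_iff.2 h).prod_fiberwise
    (g := fun j => s (.chain j) + s (.up j) + s (.down j)) fun j => by
      have := hasSum_fintype (fun k : Fin 3 => s (edgeEquiv (j, k)))
      rw [Fin.sum_univ_three] at this
      exact this
  exact h1

theorem summable_edge {s : Edge → ℝ} (h1 : Summable fun j => s (.chain j))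
    (h2 : Summable fun j => s (.up j)) (h3 : Summable fun j => s (.down j)) (h0 : ∀ e, 0 ≤ s e) :
    Summable s := by
  rw [← edgeEquiv.summable_iff, summable_prod_of_nonneg (f := s ∘ edgeEquiv) fun p => h0 _]
  refine ⟨fun j => (hasSum_fintype _).summable, ?_⟩
  refine ((h1.add h2).add h3).congr fun j => ?_
  rw [tsum_fintype, Fin.sum_univ_three]
  rfl

/-- An unconditional sum may be evaluated along the intervals `[-N, N)`, where the partial sum is `c
N - c (-N)`. -/
theorem hasSum_telescope {c : ℤ → ℂ} (hc : Tendsto c cofinite (𝓝 0)) {A : ℂ}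
    (h : HasSum (fun j => c (j + 1) - c j) A) : A = 0 := by
  have hs : Tendsto (fun N : ℕ => Finset.Ico (-(N : ℤ)) N) atTop atTop := by
    refine tendsto_atTop_finset_of_monotone (fun M N h => ?_) fun j => ⟨j.natAbs + 1, ?_⟩
    · have : (M : ℤ) ≤ N := by exact_mod_cast h
      exact Finset.Ico_subset_Ico (by lia) this
    · rw [Finset.mem_Ico]
      push_cast
      have h1 := neg_abs_le j
      have h2 := le_abs_self j
      omega
  have h1 := h.comp hs
  have h2 : ∀ N : ℕ, ∑ j ∈ Finset.Ico (-(N : ℤ)) N, (c (j + 1) - c j) = c N - c (-N) := by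
    intro N
    induction N with
    | zero => simp
    | succ n ih =>
      have : Finset.Ico (-((n + 1 : ℕ) : ℤ)) ((n + 1 : ℕ) : ℤ) =
          insert (-(n : ℤ) - 1) (insert (n : ℤ) (Finset.Ico (-(n : ℤ)) n)) := by
        ext j
        simp only [Finset.mem_insert, Finset.mem_Ico]
        push_cast
        lia
      rw [this, Finset.sum_insert, Finset.sum_insert, ih]
      · push_cast
        rw [show -(n : ℤ) - 1 + 1 = -n by ring, show -((n : ℤ) + 1) = -n - 1 by ring]
        ring
      · simp
      · simp only [Finset.mem_insert, Finset.mem_Ico]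
        lia
  have p1 : Tendsto (fun N : ℕ => c N) atTop (𝓝 0) := by
    rw [← Nat.cofinite_eq_atTop]
    exact hc.comp Nat.cast_injective.tendsto_cofinite
  have p2 : Tendsto (fun N : ℕ => c (-N)) atTop (𝓝 0) := by
    rw [← Nat.cofinite_eq_atTop]
    exact hc.comp (neg_injective.comp Nat.cast_injective).tendsto_cofinite
  have h3 := p1.sub p2
  rw [sub_zero] at h3
  exact tendsto_nhds_unique (h1.congr fun N => h2 N) h3

theorem inner_green {a b : ℝ} (ha : 0 < a) (hb : 0 < b) {ψ₁ w₁ ψ₂ w₂ : L2 a b}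
    {u₁ v₁ u₂ v₂ : Edge → ℝ → ℂ} (h₁ : IsH2 a b ψ₁ w₁ u₁ v₁) (h₂ : IsH2 a b ψ₂ w₂ u₂ v₂)
    (e : Edge) :
    inner ℂ (ψ₁ e) (w₂ e) - inner ℂ (w₁ e) (ψ₂ e) =
      (starRingEnd ℂ (u₁ e (e.length a b)) * v₂ e (e.length a b) -
        starRingEnd ℂ (v₁ e (e.length a b)) * u₂ e (e.length a b)) -
      (starRingEnd ℂ (u₁ e 0) * v₂ e 0 - starRingEnd ℂ (v₁ e 0) * u₂ e 0) := by
  have hℓ := (Edge.length_pos ha hb e).le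
  have hm : e.length a b ∈ Set.Icc 0 (e.length a b) := ⟨hℓ, le_rfl⟩
  have hw₁ := intervalIntegrable_conj (intervalIntegrable_of_mem w₁ e hm)
  have hw₂ := intervalIntegrable_of_mem w₂ e hm
  have cu : ∀ {ψ w : L2 a b} {u v : Edge → ℝ → ℂ}, IsH2 a b ψ w u v →
      ContinuousOn (u e) (Set.uIcc 0 (e.length a b)) := by
    intro ψ w u v h
    rw [Set.uIcc_of_le hℓ]
    exact (h.deriv₁ e).continuousOn hℓ (h.intervalIntegrable e hm)
  have hc : ContinuousOn (fun x => starRingEnd ℂ (u₁ e x)) (Set.uIcc 0 (e.length a b)) :=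
    Complex.continuous_conj.comp_continuousOn (cu h₁)
  have e1 := inner_eq_intervalIntegral hℓ (ψ₁ e) (w₂ e) (h₁.ae_eq e) Filter.EventuallyEq.rfl
  have e2 := inner_eq_intervalIntegral hℓ (w₁ e) (ψ₂ e) Filter.EventuallyEq.rfl (h₂.ae_eq e)
  rw [e1, e2, ← intervalIntegral.integral_sub (hw₂.continuousOn_mul hc)
    (hw₁.mul_continuousOn (cu h₂))]
  exact integral_green hℓ (h₁.deriv₁ e).conj (h₁.deriv₂ e).conj (h₂.deriv₁ e) (h₂.deriv₂ e) hw₁ hw₂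

/-- Green's identity on the comb, for two functions which satisfy `δ`-couplings of equal strengths
at all vertices except `x_0`. -/
theorem green {a b : ℝ} (ha : 0 < a) (hb : 0 < b) {g₁ g₂ : ℤ → ℝ} {θ : ℝ}
    (hg : ∀ j ≠ 0, g₁ j = g₂ j) {ψ₁ w₁ ψ₂ w₂ : L2 a b}
    {u₁ v₁ u₂ v₂ : Edge → ℝ → ℂ} (h₁ : IsH2 a b ψ₁ w₁ u₁ v₁) (h₂ : IsH2 a b ψ₂ w₂ u₂ v₂)
    (k₁ : VertexConditions a b g₁ θ u₁ v₁) (k₂ : VertexConditions a b g₂ θ u₂ v₂) :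
    inner ℂ ψ₁ w₂ - inner ℂ w₁ ψ₂ =
      (g₁ 0 - g₂ 0) * (starRingEnd ℂ (u₁ (.chain 0) a) * u₂ (.chain 0) a) := by
  set W : Edge → ℝ → ℂ := fun e x =>
    starRingEnd ℂ (u₁ e x) * v₂ e x - starRingEnd ℂ (v₁ e x) * u₂ e x with hW
  have hs₁ : HasSum (fun e => inner ℂ (ψ₁ e) (w₂ e)) (inner ℂ ψ₁ w₂) := lp.hasSum_inner ψ₁ w₂
  have hs₂ : HasSum (fun e => inner ℂ (w₁ e) (ψ₂ e)) (inner ℂ w₁ ψ₂) := lp.hasSum_inner w₁ ψ₂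
  have hs := hasSum_edge ((hs₁.sub hs₂).congr_fun fun e => (inner_green ha hb h₁ h₂ e).symm)
  set K : ℂ := (g₁ 0 - g₂ 0) * (starRingEnd ℂ (u₁ (.chain 0) a) * u₂ (.chain 0) a) with hK
  have hsingle : HasSum (fun j : ℤ => if j = 0 then K else 0) K := hasSum_ite_eq 0 K
  have hd := hs.sub hsingle
  have hc : Tendsto (fun j : ℤ => W (.chain j) 0) cofinite (𝓝 0) := by
    obtain ⟨t1, t2⟩ := h₁.tendsto_trace ha
    obtain ⟨t3, t4⟩ := h₂.tendsto_trace ha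
    have q1 := ((Complex.continuous_conj.tendsto 0).comp t1).mul t4
    have q2 := ((Complex.continuous_conj.tendsto 0).comp t2).mul t3
    have := q1.sub q2
    simp only [map_zero, mul_zero, sub_zero] at this
    exact this
  -- Grouped by vertex, the boundary terms minus the defect at `x_0` are the increments of the
  -- Wronskian along the chain. At the outer ends of the vertical edges they cancel because `exp
  -- (iθ)` is unimodular.
  have := hasSum_telescope hc (hd.congr_fun fun j => ?_)
  · linear_combination this
  have hexp : starRingEnd ℂ (Complex.exp (θ * Complex.I)) * Complex.exp (θ * Complex.I) = 1 := by
    rw [← Complex.exp_conj, ← Complex.exp_add]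
    simp
  have hgj : (if j = 0 then K else 0) =
      (g₁ j - g₂ j) * (starRingEnd ℂ (u₁ (.chain j) a) * u₂ (.chain j) a) := by
    split_ifs with h
    · rw [h]
    · rw [hg j h, sub_self, zero_mul]
  rw [hgj]
  simp only [hW, Edge.length]
  rw [k₁.cont_right, k₂.cont_right, k₁.cont_up, k₂.cont_up, k₁.cont_down, k₂.cont_down, k₁.quasi,
    k₂.quasi, k₁.quasi_deriv, k₂.quasi_deriv, map_mul, map_mul]
  have d1 := congrArg (starRingEnd ℂ) (k₁.delta j)
  have d2 := k₂.delta j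
  simp only [map_add, map_sub, map_mul, Complex.conj_ofReal] at d1
  linear_combination starRingEnd ℂ (u₁ (.chain j) a) * d2 - u₂ (.chain j) a * d1
    + (starRingEnd ℂ (v₁ (.down j) 0) * u₂ (.down j) 0 -
      starRingEnd ℂ (u₁ (.down j) 0) * v₂ (.down j) 0) * hexp

end Comb
end

/-! ### An abstract criterion for an isolated eigenvalue. -/

noncomputable section

namespace UnboundedOp

variable {H : Type*} [NormedAddCommGroup H] [InnerProductSpace ℂ H]

theorem mem_resolventSet_iff {T : H →ₗ.[ℂ] H} {z : ℂ} :
    z ∈ resolventSet T ↔ ∃ R : H →L[ℂ] H, (∀ g, (R g, z • R g + g) ∈ T.graph) ∧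
      ∀ x y, (x, y) ∈ T.graph → R (y - z • x) = x := by
  refine exists_congr fun R => and_congr (forall_congr' fun g => ?_) ?_
  · rw [LinearPMap.mem_graph_iff]
    constructor
    · rintro ⟨h, e⟩
      exact ⟨⟨R g, h⟩, rfl, sub_eq_iff_eq_add'.1 e⟩
    · rintro ⟨⟨x, hx⟩, rfl : x = R g, e⟩
      exact ⟨hx, by rw [e]; simp⟩
  · constructor
    · intro h x y hxy
      obtain ⟨ψ, rfl, rfl⟩ := (LinearPMap.mem_graph_iff T).1 hxy
      exact h ψ
    · intro h ψ
      exact h _ _ (LinearPMap.mem_graph T ψ)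

theorem mem_eigenspace_iff {T : H →ₗ.[ℂ] H} {z : ℂ} {x : H} :
    x ∈ eigenspace T z ↔ (x, z • x) ∈ T.graph := by
  rw [LinearPMap.mem_graph_iff, eigenspace, Submodule.mem_map]
  constructor
  · rintro ⟨ψ, h, rfl⟩
    exact ⟨ψ, rfl, sub_eq_zero.1 h⟩
  · rintro ⟨ψ, rfl, h⟩
    exact ⟨ψ, sub_eq_zero.2 h, rfl⟩

/-- If `T - z` has the kernel spanned by `η`, which is complemented by the kernel of a functional
`l` that contains the range of `T - z`, and if `S` is a bounded right inverse of `T - z` on the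
kernel of `l`, then `z` is isolated in the spectrum of `T`. -/
theorem exists_isolating_ball [CompleteSpace H] {T : H →ₗ.[ℂ] H} {z : ℂ} {η : H} {l : H →L[ℂ] ℂ}
    {S : H →L[ℂ] H} (hl : l η = 1) (hη : (η, z • η) ∈ T.graph)
    (hS : ∀ g, l g = 0 → (S g, z • S g + g) ∈ T.graph) (hlS : ∀ g, l (S g) = 0)
    (hran : ∀ x y, (x, y) ∈ T.graph → l (y - z • x) = 0)
    (hker : ∀ x, (x, z • x) ∈ T.graph → l x = 0 → x = 0) :
    ∃ ε > 0, ∀ w ∈ spectrum T, dist w z < ε → w = z := by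
  refine ⟨(‖S‖ + 1)⁻¹, by positivity, fun w hw hwz => ?_⟩
  by_contra hne
  refine hw (mem_resolventSet_iff.2 ?_)
  have hzw : z - w ≠ 0 := sub_ne_zero.2 (Ne.symm hne)
  have hsmall : ‖(w - z) • S‖ < 1 := by
    rw [norm_smul, ← dist_eq_norm]
    calc dist w z * ‖S‖ ≤ (‖S‖ + 1)⁻¹ * ‖S‖ := by gcongr
      _ < (‖S‖ + 1)⁻¹ * (‖S‖ + 1) := by gcongr; linarith
      _ = 1 := inv_mul_cancel₀ (by positivity)
  set U := Units.oneSub _ hsmall with hU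
  set V : H →L[ℂ] H := ↑U⁻¹ with hV
  have hUx : ∀ x, (U : H →L[ℂ] H) x = x - (w - z) • S x := fun x => rfl
  have hUV : ∀ x, V x = x + (w - z) • S (V x) := fun x => by
    have h1 : ((U : H →L[ℂ] H) * V) x = x := by rw [hV, Units.mul_inv]; rfl
    have h2 := hUx (V x)
    rw [mul_apply_eq_comp, h2] at h1
    exact sub_eq_iff_eq_add.1 h1
  have hVU : ∀ x, (U : H →L[ℂ] H) x = 0 → x = 0 := fun x hx => by
    have h1 : (V * (U : H →L[ℂ] H)) x = x := by rw [hV, Units.inv_mul]; rfl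
    rw [mul_apply_eq_comp, hx, map_zero] at h1
    exact h1.symm
  -- Split `g = l g • η + k` with `l k = 0`. On `η` the resolvent is multiplication by `(z - w)⁻¹`;
  -- on the kernel of `l` it is `S (1 - (w - z) S)⁻¹`, a Neumann series since `w` is close to `z`.
  set R : H →L[ℂ] H := (z - w)⁻¹ • l.smulRight η +
    S.comp (V.comp (ContinuousLinearMap.id ℂ H - l.smulRight η)) with hR
  have hRg : ∀ g, (R g, w • R g + g) ∈ T.graph := by
    intro g
    set k := g - l g • η with hk
    have hlk : l k = 0 := by simp [hk, hl]
    have hlh : l (V k) = 0 := by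
      rw [hUV k, map_add, hlk, map_smul, hlS, smul_zero, add_zero]
    have e : R g = ((z - w)⁻¹ * l g) • η + S (V k) := by
      simp [hR, hk, smul_smul]
    have := T.graph.add_mem (T.graph.smul_mem ((z - w)⁻¹ * l g) hη) (hS _ hlh)
    rw [e]
    convert! this using 1
    ext1
    · rfl
    · simp only [Prod.smul_mk, Prod.mk_add_mk]
      nth_rw 3 [hUV k]
      have : ((z - w)⁻¹ * l g) • z • η = ((z - w)⁻¹ * l g) • w • η + l g • η := by
        rw [smul_smul, smul_smul, ← add_smul]
        congr 1
        field_simp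
        ring
      rw [this, hk]
      module
  refine ⟨R, hRg, fun x y hxy => ?_⟩
  -- For the left inverse it suffices that `d`, which lies in the kernel of `T - w`, vanishes. The
  -- range condition gives `l d = 0`; then `d - (w - z) • S d` lies in both the kernel of `T - z`
  -- and that of `l`, so it is zero, and `U` is injective.
  set d := R (y - w • x) - x with hd
  have hdg : (d, w • d) ∈ T.graph := by
    have := T.graph.sub_mem (hRg (y - w • x)) hxy
    convert! this using 1
    ext1
    · rfl
    · simp only [hd, Prod.mk_sub_mk]
      module
  have hld : l d = 0 := by
    have := hran _ _ hdg
    rw [← sub_smul, map_smul, smul_eq_mul] at this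
    exact (mul_eq_zero.1 this).resolve_left (sub_ne_zero.2 hne)
  have he := T.graph.sub_mem hdg (T.graph.smul_mem (w - z) (hS d hld))
  have h0 : d - (w - z) • S d = 0 := by
    refine hker _ ?_ (by rw [map_sub, map_smul, hlS, hld, smul_zero, sub_zero])
    convert! he using 1
    ext1
    · rfl
    · simp only [Prod.smul_mk, Prod.mk_sub_mk]
      module
  exact sub_eq_zero.1 (hVU d h0)

end UnboundedOp

/-! ### From eigenfunctions to the difference equation. -/

namespace Comb

open Filter Topology

variable {a b κ : ℝ}

/-- The solution of `u'' = κ² u` with `u 0 = p` and `u' 0 = κ q`. -/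
def hyp (κ : ℝ) (p q : ℂ) (x : ℝ) : ℂ := p * Real.cosh (κ * x) + q * Real.sinh (κ * x)

theorem hasDerivAt_hyp (κ : ℝ) (p q : ℂ) (x : ℝ) :
    HasDerivAt (hyp κ p q) (hyp κ (κ * q) (κ * p) x) x := by
  have h := (hasDerivAt_id x).const_mul κ
  have h1 := ((Real.hasDerivAt_cosh (κ * x)).comp x h).ofReal_comp
  have h2 := ((Real.hasDerivAt_sinh (κ * x)).comp x h).ofReal_comp
  have := (h1.const_mul p).fun_add (h2.const_mul q)
  refine this.congr_deriv ?_
  rw [hyp]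
  push_cast
  ring

theorem continuous_hyp (κ : ℝ) (p q : ℂ) : Continuous (hyp κ p q) :=
  continuous_iff_continuousAt.2 fun x => (hasDerivAt_hyp κ p q x).continuousAt

/-- The Wronskian of two solutions of `u'' = κ² u` is constant. The choices `(p, q) = (0, 1)` and
`(1, 0)` give the relations between the traces at the two ends of an edge. -/
theorem transfer_zero {ℓ : ℝ} (hℓ : 0 ≤ ℓ) {u v w : ℝ → ℂ} (hu : IsPrimitive ℓ u v)
    (hv : IsPrimitive ℓ v w) (hw : IntervalIntegrable w volume 0 ℓ)
    (h : w =ᵐ[volume.restrict (Set.Ioc 0 ℓ)] fun x => (κ : ℂ) ^ 2 * u x) (p q : ℂ) :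
    hyp κ p q ℓ * v ℓ - hyp κ (κ * q) (κ * p) ℓ * u ℓ - (p * v 0 - κ * q * u 0) = 0 := by
  have := integral_green hℓ (isPrimitive_of_hasDerivAt (hasDerivAt_hyp κ p q) (continuous_hyp _ _ _))
    (isPrimitive_of_hasDerivAt (hasDerivAt_hyp κ (κ * q) (κ * p)) (continuous_hyp _ _ _)) hu hv
    ((continuous_hyp _ _ _).intervalIntegrable _ _) hw
  have h0 : ∀ p q, hyp κ p q 0 = p := fun p q => by simp [hyp]
  rw [h0, h0] at this
  rw [← this, intervalIntegral.integral_of_le hℓ]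
  refine integral_eq_zero_of_ae ?_
  filter_upwards [h] with x hx
  rw [hx]
  simp only [hyp, Pi.zero_apply]
  ring

/-- The form in terms of `b / 2`, the length of the cut vertical edges, by the duplication formulas.
-/
theorem fHat_eq (hκ : 0 < κ) (hb : 0 < b) (γ τ : ℝ) :
    fHat a b γ τ κ = γ * Real.sinh (κ * a) / (2 * κ) + Real.cosh (κ * a) +
      Real.sinh (κ * a) * (Real.cosh (κ * (b / 2)) ^ 2 + Real.sinh (κ * (b / 2)) ^ 2 - τ) /
        (2 * Real.sinh (κ * (b / 2)) * Real.cosh (κ * (b / 2))) := by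
  have hs : Real.sinh (κ * (b / 2)) ≠ 0 := (Real.sinh_pos_iff.2 (by positivity)).ne'
  have hc := (Real.cosh_pos (κ * (b / 2))).ne'
  rw [fHat, mul_add, Real.sinh_add, show κ * b = 2 * (κ * (b / 2)) by ring, Real.sinh_two_mul,
    Real.cosh_two_mul]
  field_simp
  ring

theorem exp_add_exp_neg (θ : ℝ) :
    2 * (Real.cos θ : ℂ) = Complex.exp (θ * Complex.I) + Complex.exp (-(θ * Complex.I)) := by
  rw [Complex.ofReal_cos, Complex.two_cos, neg_mul]

/-- The values of an eigenfunction at the vertices satisfy a difference equation. -/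
theorem recursion_of_eigenfunction (ha : 0 < a) (hb : 0 < b) (hκ : 0 < κ) {g : ℤ → ℝ} {θ : ℝ}
    {ψ : L2 a b} {u v : Edge → ℝ → ℂ} (H : IsH2 a b ψ ((κ : ℂ) ^ 2 • ψ) u v)
    (K : VertexConditions a b g θ u v) (j : ℤ) :
    u (.chain (j + 1)) a + u (.chain (j - 1)) a =
      2 * fHat a b (g j) (Real.cos θ) κ * u (.chain j) a := by
  have hw : ∀ e, ((κ : ℂ) ^ 2 • ψ : L2 a b) e =ᵐ[volume.restrict (Set.Ioc 0 (e.length a b))]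
      fun x => (κ : ℂ) ^ 2 * u e x := fun e => by
    filter_upwards [H.ae_eq e, Lp.coeFn_smul ((κ : ℂ) ^ 2) (ψ e)] with x h1 h2
    rw [← h1]
    exact h2
  have ht := fun e p q => transfer_zero (Edge.length_pos ha hb e).le (H.deriv₁ e) (H.deriv₂ e)
    (intervalIntegrable_of_mem _ e ⟨(Edge.length_pos ha hb e).le, le_rfl⟩) (hw e) p q
  have t1 := ht (.chain j) 0 1
  have t2 := ht (.chain (j + 1)) 0 1
  have t3 := ht (.chain (j + 1)) 1 0
  have t4 := ht (.up j) 0 1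
  have t5 := ht (.up j) 1 0
  have t6 := ht (.down j) 0 1
  have t7 := ht (.down j) 1 0
  have hd := K.delta j
  have hc := K.cont_right (j - 1)
  rw [sub_add_cancel] at hc
  simp only [hyp, Edge.length, zero_mul, one_mul, mul_one, mul_zero, add_zero, zero_add,
    zero_sub, sub_zero, K.cont_right, K.cont_up, K.cont_down, K.quasi, K.quasi_deriv, hc] at *
  rw [fHat_eq hκ hb]
  have e1 := exp_add_exp_neg θ
  have e2 : Complex.exp (θ * Complex.I) * Complex.exp (-(θ * Complex.I)) = 1 := by
    rw [← Complex.exp_add, add_neg_cancel, Complex.exp_zero]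
  have q1 : (Real.cosh (κ * a) : ℂ) ^ 2 - (Real.sinh (κ * a) : ℂ) ^ 2 = 1 := by
    exact_mod_cast Real.cosh_sq_sub_sinh_sq _
  have q2 : (Real.cosh (κ * (b / 2)) : ℂ) ^ 2 - (Real.sinh (κ * (b / 2)) : ℂ) ^ 2 = 1 := by
    exact_mod_cast Real.cosh_sq_sub_sinh_sq _
  have hs : (Real.sinh (κ * (b / 2)) : ℂ) ≠ 0 := by
    exact_mod_cast (Real.sinh_pos_iff.2 (by positivity)).ne'
  have hS : (Real.sinh (κ * a) : ℂ) ≠ 0 := by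
    exact_mod_cast (Real.sinh_pos_iff.2 (by positivity)).ne'
  have hC : (Real.cosh (κ * (b / 2)) : ℂ) ≠ 0 := by exact_mod_cast (Real.cosh_pos _).ne'
  have hk : (κ : ℂ) ≠ 0 := by exact_mod_cast hκ.ne'
  push_cast [-Complex.ofReal_sinh, -Complex.ofReal_cosh, -Complex.ofReal_cos]
  generalize Complex.exp (θ * Complex.I) = Z at *
  generalize Complex.exp (-(θ * Complex.I)) = Z' at *
  generalize (Real.cos θ : ℂ) = τ at *
  generalize (Real.cosh (κ * a) : ℂ) = C at *
  generalize (Real.sinh (κ * a) : ℂ) = S at *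
  generalize (Real.cosh (κ * (b / 2)) : ℂ) = c at *
  generalize (Real.sinh (κ * (b / 2)) : ℂ) = s at *
  generalize u (.chain j) a = y at *
  generalize u (.chain (j + 1)) a = y₁ at *
  generalize u (.chain (j - 1)) a = y₀ at *
  generalize v (.chain j) a = A at *
  generalize v (.chain (j + 1)) 0 = B at *
  generalize v (.chain (j + 1)) a = B' at *
  generalize v (.up j) 0 = P at *
  generalize v (.down j) (b / 2) = Q at *
  generalize v (.down j) 0 = D' at *
  generalize u (.down j) 0 = D at *
  -- The derivatives in the δ-coupling are now expressed by vertex values: `B` by `a1`, `A` by `t1`,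
  -- and `P`, `Q` by `a4`, `a2` after the quasiperiodic conditions eliminate the outer ends. In `P -
  -- Q` the phases combine to `Z + Z' = 2 cos θ`.
  have a1 : S * B = κ * y₁ - κ * C * y := by
    linear_combination C * t2 - S * t3 + κ * y₁ * q1
  have a2 : 2 * s * c * Q = κ * (c ^ 2 + s ^ 2) * y - κ * Z' * y := by
    linear_combination Z' * (t4 + Z * s * t7 + Z * c * t6)
      - (2 * s * c * Q - κ * (c ^ 2 + s ^ 2) * y) * e2
  have a3 : P = Z * ((c ^ 2 + s ^ 2) * Q - 2 * κ * s * c * y) := by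
    linear_combination -(t5 + Z * c * t7 + Z * s * t6)
  have a4 : 2 * s * c * P = κ * Z * y - κ * (c ^ 2 + s ^ 2) * y := by
    linear_combination 2 * s * c * a3 + Z * (c ^ 2 + s ^ 2) * a2 - κ * (c ^ 2 + s ^ 2) * y * e2
      + Z * κ * y * (c ^ 2 - s ^ 2 + 1) * q2
  field_simp
  linear_combination s * c * S * hd - s * c * (a1 - t1) - S * (a4 - a2) / 2 + S * κ * y * e1 / 2

end Comb
end

/-! ### Decaying solutions of the difference equation. -/

noncomputable section

namespace Comb

open Filter Topology

variable {a b κ : ℝ}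

/-- A solution of a difference equation with constant coefficients for `j ≥ 1` that tends to zero
is geometric. -/
theorem geometric_of_recursion {y : ℕ → ℂ} {f : ℂ} (hy : Tendsto y atTop (𝓝 0))
    (h : ∀ n, y (n + 2) + y n = 2 * f * y (n + 1)) {μ : ℂ} (hμ : μ ^ 2 - 2 * f * μ + 1 = 0)
    (hμ1 : ‖μ‖ ≤ 1) (n : ℕ) : y n = μ ^ n * y 0 := by
  have h0 : μ ≠ 0 := by rintro rfl; simp at hμ
  -- The other characteristic root is `1/μ`, so `y (n+1) - μ y n` is multiplied by `1/μ` at each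
  -- step. As `‖μ‖ ≤ 1`, it can tend to zero only if it vanishes.
  have hz : ∀ n, μ ^ n * (y (n + 1) - μ * y n) = y 1 - μ * y 0 := by
    intro n
    induction n with
    | zero => simp
    | succ n ih => rw [← ih]; linear_combination μ ^ (n + 1) * h n - μ ^ n * y (n + 1) * hμ
  have ht : Tendsto (fun n => y (n + 1) - μ * y n) atTop (𝓝 0) := by
    simpa using ((tendsto_add_atTop_iff_nat 1).2 hy).sub (hy.const_mul μ)
  have h1 : y 1 - μ * y 0 = 0 := by
    refine norm_le_zero_iff.1 (ge_of_tendsto' (by simpa using ht.norm) fun n => ?_)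
    rw [← hz n, norm_mul, norm_pow]
    exact mul_le_of_le_one_left (norm_nonneg _) (pow_le_one₀ (norm_nonneg _) hμ1)
  induction n with
  | zero => simp
  | succ n ih =>
    have h2 := hz n
    rw [h1] at h2
    have h3 := (mul_eq_zero.1 h2).resolve_left (pow_ne_zero _ h0)
    rw [sub_eq_zero.1 h3, ih]
    ring

/-- If a two-sided solution of the difference equation with a defect at `0` tends to zero and does
not vanish at `0`, then the equation for the defect has the form stated. -/
theorem dichotomy_of_recursion {y : ℤ → ℂ} {f f' : ℝ} (hy : Tendsto y cofinite (𝓝 0))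
    (h : ∀ j ≠ 0, y (j + 1) + y (j - 1) = 2 * f * y j)
    (h0 : y 1 + y (-1) = 2 * f' * y 0) (hy0 : y 0 ≠ 0) :
    (f < -1 ∧ f' = f + √(f ^ 2 - 1)) ∨ (1 < f ∧ f' = f - √(f ^ 2 - 1)) := by
  have hr : Tendsto (fun n : ℕ => y n) atTop (𝓝 0) := by
    rw [← Nat.cofinite_eq_atTop]
    exact hy.comp Nat.cast_injective.tendsto_cofinite
  have hl : Tendsto (fun n : ℕ => y (-n)) atTop (𝓝 0) := by
    rw [← Nat.cofinite_eq_atTop]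
    exact hy.comp (neg_injective.comp Nat.cast_injective).tendsto_cofinite
  -- Both half-lines are geometric with the same ratio `μ`, so the equation at `0` reads `2 μ y 0 =
  -- 2 f' y 0`. If `‖μ‖ = 1`, then `‖y n‖` would be constant and nonzero.
  have key : ∀ μ : ℂ, μ ^ 2 - 2 * f * μ + 1 = 0 → ‖μ‖ ≤ 1 → ‖μ‖ < 1 ∧ (f' : ℂ) = μ := by
    intro μ hμ hμ1
    have e1 := geometric_of_recursion hr (fun n => by
      have := h (n + 1) (by omega)
      push_cast
      rw [← this]; congr 2; ring) hμ hμ1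
    have e2 := geometric_of_recursion hl (fun n => by
      have := h (-(n + 1)) (by omega)
      push_cast
      rw [← this, add_comm]; congr 2; ring) hμ hμ1
    constructor
    · refine lt_of_le_of_ne hμ1 fun h1 => hy0 ?_
      have : Tendsto (fun n : ℕ => ‖y n‖) atTop (𝓝 0) := by simpa using hr.norm
      have h2 : Tendsto (fun n : ℕ => ‖y n‖) atTop (𝓝 ‖y 0‖) := by
        refine tendsto_const_nhds.congr fun n => ?_
        rw [e1 n, norm_mul, norm_pow, h1]
        simp
      exact norm_eq_zero.1 (tendsto_nhds_unique h2 this)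
    · have a1 := e1 1
      have a2 := e2 1
      simp only [Nat.cast_one, pow_one, Nat.cast_zero, neg_zero] at a1 a2
      rw [a1, a2] at h0
      have : 2 * y 0 * (f' - μ) = 0 := by linear_combination -h0
      rcases mul_eq_zero.1 this with h | h
      · exact absurd (mul_eq_zero.1 h) (by simp [hy0])
      · exact sub_eq_zero.1 h
  -- In this case the roots lie on the unit circle, which `key` excludes; otherwise they are real
  -- and one of them lies in the open unit disc.
  by_cases hf : |f| ≤ 1
  · have hf2 : f ^ 2 ≤ 1 := (sq_le_one_iff_abs_le_one f).2 hf
    have hsq : (√(1 - f ^ 2)) ^ 2 = 1 - f ^ 2 := Real.sq_sqrt (by linarith)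
    have hn : ‖(f + √(1 - f ^ 2) * Complex.I : ℂ)‖ = 1 := by
      rw [Complex.norm_add_mul_I, hsq]
      simp
    have := (key (f + √(1 - f ^ 2) * Complex.I) (by
      have hsq' : ((√(1 - f ^ 2) : ℝ) : ℂ) ^ 2 = 1 - (f : ℂ) ^ 2 := by exact_mod_cast hsq
      linear_combination (√(1 - f ^ 2) : ℂ) ^ 2 * Complex.I_sq - hsq') hn.le).1
    linarith
  have hf1 : 1 < |f| := not_le.1 hf
  have hf2 : 1 < f ^ 2 := (one_lt_sq_iff_one_lt_abs f).2 hf1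
  have hsq : (√(f ^ 2 - 1)) ^ 2 = f ^ 2 - 1 := Real.sq_sqrt (by linarith)
  have hpos : 0 < √(f ^ 2 - 1) := Real.sqrt_pos.2 (by linarith)
  have key' : ∀ μ : ℝ, μ ^ 2 - 2 * f * μ + 1 = 0 → |μ| ≤ 1 → f' = μ := by
    intro μ h1 h2
    have := (key μ (by exact_mod_cast h1) (by simpa using h2)).2
    exact_mod_cast this
  rcases lt_abs.1 hf1 with h1 | h1
  · refine Or.inr ⟨h1, key' _ (by linear_combination hsq) ?_⟩
    rw [abs_le]
    constructor <;> nlinarith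
  · refine Or.inl ⟨by linarith, key' _ (by linear_combination hsq) ?_⟩
    rw [abs_le]
    constructor <;> nlinarith

/-- Conversely, in the case of the dichotomy there is a decaying solution. -/
theorem exists_decaying_solution {f f' : ℝ}
    (h : (f < -1 ∧ f' = f + √(f ^ 2 - 1)) ∨ (1 < f ∧ f' = f - √(f ^ 2 - 1))) :
    f' ≠ f ∧ ∃ y : ℤ → ℂ, y 0 = 1 ∧ Summable (fun j => ‖y j‖ ^ 2) ∧
      ∀ j, y (j + 1) + y (j - 1) = 2 * (if j = 0 then f' else f : ℝ) * y j := by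
  have hf2 : 1 < f ^ 2 := by
    rcases h with h | h <;> nlinarith
  have hsq : (√(f ^ 2 - 1)) ^ 2 = f ^ 2 - 1 := Real.sq_sqrt (by linarith)
  have hpos : 0 < √(f ^ 2 - 1) := Real.sqrt_pos.2 (by linarith)
  have hq : f' ^ 2 - 2 * f * f' + 1 = 0 := by
    rcases h with ⟨-, h⟩ | ⟨-, h⟩ <;> rw [h] <;> linear_combination hsq
  have hlt : |f'| < 1 := by
    rw [abs_lt]
    rcases h with ⟨h1, h⟩ | ⟨h1, h⟩ <;> rw [h] <;> constructor <;> nlinarith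
  -- The number `f'` is itself the characteristic root of modulus less than one, so `f' ^ |j|`
  -- solves the equation at `0` too.
  refine ⟨?_, fun j => (f' : ℂ) ^ j.natAbs, by simp, ?_, fun j => ?_⟩
  · rcases h with ⟨-, h⟩ | ⟨-, h⟩ <;> rw [h] <;> intro <;> linarith
  · have hs : Summable fun n : ℕ => (|f'| ^ 2) ^ n :=
      summable_geometric_of_lt_one (by positivity) (by nlinarith [abs_nonneg f'])
    refine Summable.of_nat_of_neg ?_ ?_ <;>
    · refine hs.congr fun n => ?_
      simp only [Int.natAbs_neg, Int.natAbs_natCast, norm_pow, Complex.norm_real, Real.norm_eq_abs]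
      ring
  · have hq' : (f' : ℂ) ^ 2 - 2 * f * f' + 1 = 0 := by exact_mod_cast hq
    rcases lt_trichotomy j 0 with hj | rfl | hj
    · obtain ⟨n, rfl⟩ : ∃ n : ℕ, j = -(n + 1) := ⟨(-j - 1).toNat, by omega⟩
      beta_reduce
      rw [if_neg hj.ne, show (-((n : ℤ) + 1) + 1).natAbs = n by omega,
        show (-((n : ℤ) + 1) - 1).natAbs = n + 2 by omega,
        show (-((n : ℤ) + 1)).natAbs = n + 1 by omega]
      linear_combination (f' : ℂ) ^ n * hq'
    · simp
      ring
    · obtain ⟨n, rfl⟩ : ∃ n : ℕ, j = n + 1 := ⟨(j - 1).toNat, by omega⟩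
      beta_reduce
      rw [if_neg hj.ne', show ((n : ℤ) + 1 + 1).natAbs = n + 2 by omega,
        show ((n : ℤ) + 1 - 1).natAbs = n by omega,
        show ((n : ℤ) + 1).natAbs = n + 1 by omega]
      linear_combination (f' : ℂ) ^ n * hq'

/-! ### From square summable vertex values to eigenfunctions. -/

theorem summable_norm_sq_combine {ι : Type*} {x y : ι → ℂ} (c d : ℂ)
    (hx : Summable fun i => ‖x i‖ ^ 2) (hy : Summable fun i => ‖y i‖ ^ 2) :
    Summable fun i => ‖c * x i + d * y i‖ ^ 2 := by
  refine Summable.of_nonneg_of_le (fun i => by positivity) (fun i => ?_)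
    ((hx.mul_left (2 * ‖c‖ ^ 2)).add (hy.mul_left (2 * ‖d‖ ^ 2)))
  have := norm_add_le (c * x i) (d * y i)
  rw [norm_mul, norm_mul] at this
  calc ‖c * x i + d * y i‖ ^ 2 ≤ (‖c‖ * ‖x i‖ + ‖d‖ * ‖y i‖) ^ 2 := by gcongr
    _ ≤ _ := by nlinarith [sq_nonneg (‖c‖ * ‖x i‖ - ‖d‖ * ‖y i‖)]

/-- Only two edge lengths occur, hence a bound uniform in the edge. -/
theorem exists_norm_hyp_le (a b κ : ℝ) (p q : ℂ) : ∃ M, ∀ e : Edge,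
    ‖(memLp_of_continuous (ℓ := e.length a b) (continuous_hyp κ p q)).toLp‖ ≤ M := by
  refine ⟨max ‖(memLp_of_continuous (ℓ := a) (continuous_hyp κ p q)).toLp‖
    ‖(memLp_of_continuous (ℓ := b / 2) (continuous_hyp κ p q)).toLp‖, fun e => ?_⟩
  cases e
  · exact le_max_left _ _
  · exact le_max_right _ _
  · exact le_max_right _ _

/-- Square summable coefficients on the edges define an element of `L²(Γ₀)` that solves
`ψ'' = κ² ψ` on every edge. -/
theorem exists_isH2_hyp (a b κ : ℝ) {p q : Edge → ℂ} (hp : Summable fun e => ‖p e‖ ^ 2)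
    (hq : Summable fun e => ‖q e‖ ^ 2) :
    ∃ ψ : L2 a b, IsH2 a b ψ ((κ : ℂ) ^ 2 • ψ) (fun e => hyp κ (p e) (q e))
      (fun e => hyp κ (κ * q e) (κ * p e)) := by
  have hm : ∀ e : Edge, MemLp (hyp κ (p e) (q e)) 2 (volume.restrict (Set.Ioc 0 (e.length a b))) :=
    fun e => memLp_of_continuous (continuous_hyp _ _ _)
  obtain ⟨M, hM⟩ := exists_norm_hyp_le a b κ 1 0
  obtain ⟨N, hN⟩ := exists_norm_hyp_le a b κ 0 1
  have hbound : ∀ e, ‖(hm e).toLp‖ ≤ ‖p e‖ * M + ‖q e‖ * N := by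
    intro e
    have : (hm e).toLp = p e • (memLp_of_continuous (continuous_hyp κ 1 0)).toLp +
        q e • (memLp_of_continuous (continuous_hyp κ 0 1)).toLp := by
      rw [← MemLp.toLp_const_smul, ← MemLp.toLp_const_smul, ← MemLp.toLp_add]
      congr 1
      funext x
      simp [hyp]
    rw [this]
    refine (norm_add_le _ _).trans ?_
    rw [norm_smul, norm_smul]
    gcongr
    · exact hM e
    · exact hN e
  have hmem : Memℓp (fun e => (hm e).toLp) 2 := by
    refine memℓp_gen ?_
    have := summable_norm_sq_combine (x := fun e => ((‖p e‖ : ℝ) : ℂ))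
      (y := fun e => ((‖q e‖ : ℝ) : ℂ)) M N (by simpa using hp) (by simpa using hq)
    refine Summable.of_nonneg_of_le (fun e => by positivity) (fun e => ?_) this
    rw [ENNReal.toReal_ofNat, Real.rpow_ofNat]
    gcongr
    refine (hbound e).trans ?_
    rw [← Complex.ofReal_mul, ← Complex.ofReal_mul, ← Complex.ofReal_add, Complex.norm_real]
    refine (le_abs_self _).trans_eq' ?_
    ring
  refine ⟨⟨_, hmem⟩, fun e => MemLp.coeFn_toLp (hm e), fun e => ?_, fun e => ?_⟩
  · exact isPrimitive_of_hasDerivAt (hasDerivAt_hyp κ _ _) (continuous_hyp _ _ _)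
  · refine (isPrimitive_of_hasDerivAt (hasDerivAt_hyp κ _ _) (continuous_hyp _ _ _)).congr ?_
    filter_upwards [Lp.coeFn_smul ((κ : ℂ) ^ 2) (hm e).toLp, MemLp.coeFn_toLp (hm e)] with x h1 h2
    refine Eq.trans ?_ h1.symm
    rw [Pi.smul_apply, h2, smul_eq_mul]
    simp only [hyp]
    ring

/-- A square summable solution of the difference equation yields an eigenfunction. -/
theorem exists_eigenfunction (ha : 0 < a) (hb : 0 < b) (hκ : 0 < κ) {g : ℤ → ℝ} {θ : ℝ}
    {y : ℤ → ℂ} (hy : Summable fun j => ‖y j‖ ^ 2)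
    (h : ∀ j, y (j + 1) + y (j - 1) = 2 * fHat a b (g j) (Real.cos θ) κ * y j) :
    ∃ (ψ : L2 a b) (u v : Edge → ℝ → ℂ), IsH2 a b ψ ((κ : ℂ) ^ 2 • ψ) u v ∧
      VertexConditions a b g θ u v ∧ ∀ j, u (.chain j) a = y j := by
  set C : ℂ := ((Real.cosh (κ * a) : ℝ) : ℂ) with hC
  set S : ℂ := ((Real.sinh (κ * a) : ℝ) : ℂ) with hS
  set c : ℂ := ((Real.cosh (κ * (b / 2)) : ℝ) : ℂ) with hc
  set s : ℂ := ((Real.sinh (κ * (b / 2)) : ℝ) : ℂ) with hs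
  set Z := Complex.exp (θ * Complex.I) with hZ
  set Z' := Complex.exp (-(θ * Complex.I)) with hZ'
  have e1 : 2 * (Real.cos θ : ℂ) = Z + Z' := exp_add_exp_neg θ
  have e2 : Z * Z' = 1 := by
    rw [← Complex.exp_add, add_neg_cancel, Complex.exp_zero]
  have q1 : C ^ 2 - S ^ 2 = 1 := by
    rw [hC, hS]
    exact_mod_cast Real.cosh_sq_sub_sinh_sq _
  have q2 : c ^ 2 - s ^ 2 = 1 := by
    rw [hc, hs]
    exact_mod_cast Real.cosh_sq_sub_sinh_sq _
  have hs0 : s ≠ 0 := by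
    rw [hs]
    exact_mod_cast (Real.sinh_pos_iff.2 (by positivity)).ne'
  have hS0 : S ≠ 0 := by
    rw [hS]
    exact_mod_cast (Real.sinh_pos_iff.2 (by positivity)).ne'
  have hc0 : c ≠ 0 := by
    rw [hc]
    exact_mod_cast (Real.cosh_pos _).ne'
  have hk : (κ : ℂ) ≠ 0 := by exact_mod_cast hκ.ne'
  have hy' : Summable fun j => ‖y (j - 1)‖ ^ 2 :=
    (Equiv.subRight (1 : ℤ)).summable_iff.2 hy
  -- On `up j` the solution is `y j (cosh + r sinh)`. The quasiperiodic conditions then fix the data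
  -- of `down j`, and `r` is the slope for which that edge returns to the value `y j` at `x_j`. On
  -- the chain, `q` is chosen to reach `y j` at the coordinate `a`.
  obtain ⟨r, hr⟩ : ∃ r : ℂ, 2 * s * c * r = Z - (c ^ 2 + s ^ 2) :=
    ⟨(Z - (c ^ 2 + s ^ 2)) / (2 * s * c), by field_simp⟩
  set p : Edge → ℂ := fun e => match e with
    | .chain j => y (j - 1)
    | .up j => y j
    | .down j => Z' * (c + r * s) * y j with hp
  set q : Edge → ℂ := fun e => match e with
    | .chain j => (y j - C * y (j - 1)) / S
    | .up j => r * y j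
    | .down j => Z' * (s + r * c) * y j with hq
  have hmul : ∀ d : ℂ, Summable fun j => ‖d * y j‖ ^ 2 := fun d => by
    simpa using summable_norm_sq_combine d 0 hy hy
  obtain ⟨ψ, H⟩ := exists_isH2_hyp a b κ (p := p) (q := q)
    (summable_edge hy' hy (hmul _) fun e => by positivity)
    (summable_edge (by
      refine (summable_norm_sq_combine (1 / S) (-C / S) hy hy').congr fun j => ?_
      simp only [hq]
      congr 2
      ring) (hmul _) (hmul _) fun e => by positivity)
  have h0 : ∀ p q, hyp κ p q 0 = p := fun p q => by simp [hyp]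
  have hA : ∀ p q, hyp κ p q a = p * C + q * S := fun p q => rfl
  have hB : ∀ p q, hyp κ p q (b / 2) = p * c + q * s := fun p q => rfl
  have hy1 : ∀ j, hyp κ (p (.chain j)) (q (.chain j)) a = y j := fun j => by
    simp only [hp, hq, hA]
    field_simp
    ring
  refine ⟨ψ, _, _, H, ⟨fun j => ?_, fun j => ?_, fun j => ?_, fun j => ?_, fun j => ?_, fun j => ?_⟩,
    hy1⟩
  · rw [hy1, h0]
    simp [hp]
  · rw [hy1, h0]
  · rw [hy1, hB]
    simp only [hp, hq]
    linear_combination Z' * y j * hr + y j * e2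
  · rw [hy1]
    simp only [h0, hA, hB, hp, hq, add_sub_cancel_right]
    have := h j
    rw [fHat_eq hκ hb] at this
    push_cast [-Complex.ofReal_sinh, -Complex.ofReal_cosh, -Complex.ofReal_cos] at this
    rw [← hC, ← hS, ← hc, ← hs] at this
    have hrec : 2 * s * c * κ * (y (j + 1) + y (j - 1)) =
        2 * s * c * (g j * S + 2 * κ * C) * y j +
          2 * κ * S * (c ^ 2 + s ^ 2 - Real.cos θ) * y j := by
      rw [this]
      field_simp
    have hq₁ : S * ((y (j + 1) - C * y j) / S) = y (j + 1) - C * y j := mul_div_cancel₀ _ hS0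
    have hq₀ : S * ((y j - C * y (j - 1)) / S) = y j - C * y (j - 1) := mul_div_cancel₀ _ hS0
    generalize (y (j + 1) - C * y j) / S = w₁ at *
    generalize (y j - C * y (j - 1)) / S = w₀ at *
    refine mul_left_cancel₀ (mul_ne_zero (mul_ne_zero (mul_ne_zero two_ne_zero hs0) hc0) hS0) ?_
    have hK : (c ^ 2 + s ^ 2) ^ 2 - 4 * s ^ 2 * c ^ 2 = 1 := by
      linear_combination (c ^ 2 - s ^ 2 + 1) * q2
    have hr' : 2 * s * c * (r - Z' * (2 * s * c + r * (c ^ 2 + s ^ 2))) =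
        2 * Real.cos θ - 2 * (c ^ 2 + s ^ 2) := by
      linear_combination (1 - Z' * (c ^ 2 + s ^ 2)) * hr - e1 + Z' * hK - (c ^ 2 + s ^ 2) * e2
    linear_combination hrec + S * κ * y j * hr' + 2 * s * c * κ * (hq₁ - C * hq₀)
      + 2 * s * c * κ * y (j - 1) * q1
  · rw [h0, hB]
    simp only [hp, hq]
    linear_combination -(c + r * s) * y j * e2
  · rw [h0, hB]
    simp only [hp, hq]
    linear_combination -κ * (s + r * c) * y j * e2

end Comb
end

/-! ### From an eigenfunction to the discrete spectrum, and the criterion. -/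

noncomputable section

namespace Comb

open Filter Topology UnboundedOp

variable {a b κ : ℝ}

theorem mem_graph_perturbed (ha : 0 < a) (hb : 0 < b) {γ γ' θ : ℝ} {x y : L2 a b} :
    (x, y) ∈ (perturbed a b γ γ' θ).graph ↔ ∃ u v, IsH2 a b x (-y) u v ∧
      VertexConditions a b (fun j => if j = 0 then γ' else γ) θ u v := by
  rw [perturbed, hamiltonian_graph ha hb]
  rfl

/-- The vertex conditions at `x_0` do not depend on the strength of the coupling there, for
functions that vanish at `x_0`. -/
theorem VertexConditions.of_eq_zero {γ γ' γ'' θ : ℝ} {u v : Edge → ℝ → ℂ}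
    (K : VertexConditions a b (fun j => if j = 0 then γ' else γ) θ u v)
    (h : u (.chain 0) a = 0) :
    VertexConditions a b (fun j => if j = 0 then γ'' else γ) θ u v where
  __ := K
  delta j := by
    rw [K.delta j]
    by_cases hj : j = 0
    · rw [hj, h, mul_zero, mul_zero]
    · simp [hj]

/-- Functions vanishing at `x_0` satisfy the perturbed and the unperturbed conditions
simultaneously. Hence subtracting a multiple of `η` reduces kernel questions to the unperturbed
operator, and the unperturbed resolvent at `E` serves as a right inverse on the orthogonal
complement of `η`. -/
theorem discreteSpectrum_of_eigenfunction (ha : 0 < a) (hb : 0 < b) {γ γ' θ E : ℝ} (hγ : γ' ≠ γ)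
    (hgap : (E : ℂ) ∈ resolventSet (unperturbed a b γ θ)) {η : L2 a b} {u v : Edge → ℝ → ℂ}
    (H : IsH2 a b η (-((E : ℂ) • η)) u v)
    (K : VertexConditions a b (fun j => if j = 0 then γ' else γ) θ u v)
    (h0 : u (.chain 0) a = 1) :
    (E : ℂ) ∈ discreteSpectrum (perturbed a b γ γ' θ) := by
  obtain ⟨R, hR, hR'⟩ := mem_resolventSet_iff.1 hgap
  have hinj : ∀ x, (x, (E : ℂ) • x) ∈ (perturbed a b γ γ θ).graph → x = 0 := fun x hx => by
    rw [← hR' _ _ hx, sub_self, map_zero]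
  have hηg : (η, (E : ℂ) • η) ∈ (perturbed a b γ γ' θ).graph :=
    (mem_graph_perturbed ha hb).2 ⟨u, v, H, K⟩
  have hη : η ≠ 0 := by
    rintro rfl
    have hz := (isH2_zero a b)
    have hm : a ∈ Set.Icc 0 a := ⟨ha.le, le_rfl⟩
    have := ((H.deriv₁ (.chain 0)).ae_eq_zero ha (H.intervalIntegrable (.chain 0) hm) (by
      filter_upwards [H.ae_eq (.chain 0), hz.ae_eq (.chain 0)] with x h1 h2
      exact h1.symm.trans h2)).1 a hm
    rw [h0] at this
    exact one_ne_zero this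
  have hspan : ∀ x, (x, (E : ℂ) • x) ∈ (perturbed a b γ γ' θ).graph → ∃ c : ℂ, x = c • η := by
    intro x hx
    obtain ⟨u', v', H', K'⟩ := (mem_graph_perturbed ha hb).1 hx
    refine ⟨u' (.chain 0) a, ?_⟩
    have H'' := H.combine (-u' (.chain 0) a) H'
    have K'' := (K.combine (-u' (.chain 0) a) K').of_eq_zero (γ'' := γ) (by simp [h0])
    have := hinj (-u' (.chain 0) a • η + x) ((mem_graph_perturbed ha hb).2 ⟨_, _, by
      convert! H'' using 1
      module, K''⟩)
    rw [neg_smul, neg_add_eq_zero] at this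
    exact this.symm
  -- Used twice: `γ'' = γ'` shows that the range of the perturbed operator minus `E` is orthogonal
  -- to `η`; `γ'' = γ` shows that `R x` vanishes at `x_0` when `x` is orthogonal to `η`.
  have hgreen : ∀ {γ'' : ℝ} {x y : L2 a b}, (x, y) ∈ (perturbed a b γ γ'' θ).graph →
      ∃ u₂ v₂, IsH2 a b x (-y) u₂ v₂ ∧
        VertexConditions a b (fun j => if j = 0 then γ'' else γ) θ u₂ v₂ ∧
        inner ℂ η (y - (E : ℂ) • x) = (γ'' - γ') * u₂ (.chain 0) a := by
    intro γ'' x y hxy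
    obtain ⟨u₂, v₂, H₂, K₂⟩ := (mem_graph_perturbed ha hb).1 hxy
    refine ⟨u₂, v₂, H₂, K₂, ?_⟩
    have := green ha hb (fun j hj => by simp [hj]) H H₂ K K₂
    simp only [if_true, h0, map_one, one_mul, inner_neg_right, inner_neg_left, inner_smul_left,
      Complex.conj_ofReal] at this
    rw [inner_sub_right, inner_smul_right]
    linear_combination -this
  have hinner : inner ℂ η η ≠ 0 := inner_self_ne_zero.2 hη
  set l : L2 a b →L[ℂ] ℂ := (inner ℂ η η)⁻¹ • innerSL ℂ η with hl
  have hlx : ∀ x, l x = (inner ℂ η η)⁻¹ * inner ℂ η x := fun x => rfl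
  have hlη : l η = 1 := by rw [hlx, inv_mul_cancel₀ hinner]
  -- Projecting `R` along `η` enforces `l (S x) = 0`; the subtracted multiple of `η` is in the
  -- kernel, so `S` stays a right inverse on the kernel of `l`.
  refine ⟨?_, ?_, exists_isolating_ball (η := η) (l := l)
    (S := (ContinuousLinearMap.id ℂ _ - l.smulRight η).comp R) hlη hηg ?_ ?_ ?_ ?_⟩
  · intro h
    have := mem_eigenspace_iff.2 hηg
    rw [h] at this
    exact hη this
  · have hle : eigenspace (perturbed a b γ γ' θ) E ≤ Submodule.span ℂ {η} := fun x hx => by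
      obtain ⟨c, rfl⟩ := hspan x (mem_eigenspace_iff.1 hx)
      exact Submodule.smul_mem _ _ (Submodule.mem_span_singleton_self η)
    exact Submodule.finiteDimensional_of_le hle
  · intro x hx
    have hx' : inner ℂ η x = 0 := by
      rw [hlx] at hx
      exact (mul_eq_zero.1 hx).resolve_left (inv_ne_zero hinner)
    obtain ⟨u₂, v₂, H₂, K₂, e⟩ := hgreen (hR x)
    rw [add_sub_cancel_left, hx'] at e
    have hne : (γ : ℂ) - γ' ≠ 0 := sub_ne_zero.2 (by exact_mod_cast hγ.symm)
    have hz := (mul_eq_zero.1 e.symm).resolve_left hne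
    have hm : (R x, (E : ℂ) • R x + x) ∈ (perturbed a b γ γ' θ).graph :=
      (mem_graph_perturbed ha hb).2 ⟨u₂, v₂, H₂, K₂.of_eq_zero hz⟩
    have := (perturbed a b γ γ' θ).graph.sub_mem hm
      ((perturbed a b γ γ' θ).graph.smul_mem (l (R x)) hηg)
    convert! this using 1
    ext1
    · rfl
    · simp only [Prod.smul_mk, Prod.mk_sub_mk, ContinuousLinearMap.comp_apply,
        sub_apply, ContinuousLinearMap.smulRight_apply,
        ContinuousLinearMap.id_apply]
      module
  · intro x
    simp [hlη]
  · intro x y hxy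
    obtain ⟨u₂, v₂, -, -, e⟩ := hgreen hxy
    rw [hlx, e, sub_self, zero_mul, mul_zero]
  · intro x hx hlx0
    obtain ⟨c, rfl⟩ := hspan x hx
    rw [map_smul, hlη, smul_eq_mul, mul_one] at hlx0
    rw [hlx0, zero_smul]

end Comb
end

theorem corollary3p3 (a b γ γ' θ₂ : ℝ) (ha : 0 < a) (hb : 0 < b)
    (hθ₂ : θ₂ ∈ Set.Icc (-Real.pi) Real.pi) (E : ℝ) (hE : E < 0)
    (hgap : (E : ℂ) ∉ UnboundedOp.spectrum (Comb.unperturbed a b γ θ₂))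
    (κ : ℝ) (hκ : κ = Real.sqrt |E|) (τ : ℝ) (hτ : τ = Real.cos θ₂) :
    (E : ℂ) ∈ UnboundedOp.discreteSpectrum (Comb.perturbed a b γ γ' θ₂) ↔
      (Comb.fHat a b γ τ κ < -1 ∧
        Comb.fHat a b γ' τ κ =
          Comb.fHat a b γ τ κ + Real.sqrt (Comb.fHat a b γ τ κ ^ 2 - 1)) ∨
      (1 < Comb.fHat a b γ τ κ ∧
        Comb.fHat a b γ' τ κ =
          Comb.fHat a b γ τ κ - Real.sqrt (Comb.fHat a b γ τ κ ^ 2 - 1)) := by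
  have hκ0 : 0 < κ := by
    rw [hκ]
    exact Real.sqrt_pos.2 (abs_pos.2 hE.ne)
  have hκE : (κ : ℂ) ^ 2 = -E := by
    have : κ ^ 2 = -E := by rw [hκ, Real.sq_sqrt (abs_nonneg E), abs_of_neg hE]
    exact_mod_cast this
  have hneg : ∀ x : Comb.L2 a b, -((E : ℂ) • x) = (κ : ℂ) ^ 2 • x := fun x => by
    rw [hκE, neg_smul]
  have hgap' : (E : ℂ) ∈ UnboundedOp.resolventSet (Comb.unperturbed a b γ θ₂) := not_not.1 hgap
  subst hτ
  constructor
  · rintro ⟨hne, -, -⟩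
    obtain ⟨x, hx, hx0⟩ := (Submodule.ne_bot_iff _).1 hne
    obtain ⟨u, v, H, K⟩ := (Comb.mem_graph_perturbed ha hb).1
      (UnboundedOp.mem_eigenspace_iff.1 hx)
    obtain ⟨R, -, hR⟩ := UnboundedOp.mem_resolventSet_iff.1 hgap'
    have hu0 : u (.chain 0) a ≠ 0 := fun h0 => hx0 <| by
      have := hR x ((E : ℂ) • x) ((Comb.mem_graph_perturbed ha hb).2 ⟨u, v, H, K.of_eq_zero h0⟩)
      rw [← this, sub_self, map_zero]
    rw [hneg] at H
    have hrec := Comb.recursion_of_eigenfunction ha hb hκ0 H K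
    refine Comb.dichotomy_of_recursion (y := fun j => u (.chain j) a) ?_ (fun j hj => ?_) ?_ hu0
    -- The trace at the end `a` of `chain j` is the trace at `0` of `chain (j + 1)`.
    · have := (H.tendsto_trace ha).1.comp (add_left_injective (1 : ℤ)).tendsto_cofinite
      exact this.congr fun j => K.cont_right j
    · simpa [hj] using hrec j
    · simpa using hrec 0
  · intro h
    obtain ⟨hf, y, hy0, hys, hrec⟩ := Comb.exists_decaying_solution h
    obtain ⟨η, u, v, H, K, hu⟩ := Comb.exists_eigenfunction ha hb hκ0
      (g := fun j => if j = 0 then γ' else γ) (θ := θ₂) hys fun j => by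
        rw [hrec j]
        split_ifs <;> rfl
    rw [← hneg] at H
    exact Comb.discreteSpectrum_of_eigenfunction ha hb (fun h => hf (by rw [h])) hgap' H K
      ((hu 0).trans hy0)
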